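/- Let $p$ be a prime, $N\ge 1$ an integer and $s>-1$ a real number. Write $(a;q)_n=\prod_{j=0}^{n-1}(1-aq^j)$. Let $\Delta_N$ be the (countable, discrete) set of tuples $\mathbf k=(k_1\ge k_2\ge\dots\ge k_N)$ with entries in $\mathbb Z\cup\{-\infty\}$. Every $\mathbf Z\in \mathrm{Mat}(N,\mathbb Q_p)$ can be written as $\mathbf Z=\mathbf B\,\mathrm{diag}(p^{-k_1},\dots,p^{-k_N})\,\mathbf C$ with $\mathbf B,\mathbf C\in \mathrm{GL}(N,\mathbb Z_p)$ (where $p^{-(-\infty)}=0$) for a unique $\mathbf k=\mathsf{Sing}_N(\mathbf Z)\in\Delta_N$. Put $\gamma(\mathbf Z)=\prod_{k_j>0}p^{k_j}$, let $\mathsf{vol}$ be the Haar measure on $\mathrm{Mat}(N,\mathbb Q_p)$ with $\mathsf{vol}(\mathrm{Mat}(N,\mathbb Z_p))=1$, and let $$d\mathsf M_N^{(s)}(\mathbf Z)=\frac{(p^{-1-s};p^{-1})_N^2}{(p^{-1-s};p^{-1})_{2N}}\,\gamma(\mathbf Z)^{-s-2N}\,d\mathsf{vol}(\mathbf Z),\qquad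 \mathsf m_N^{(s)}=(\mathsf{Sing}_N)_*\mathsf M_N^{(s)},$$ so that $\mathsf M_N^{(s)}$ is the $p$-adic Hua probability measure and $\mathsf m_N^{(s)}$ is the law of its singular numbers. For $\mathbf k\in\Delta_N$ and $i\in\mathbb Z\cup\{-\infty\}$ let $l_i(\mathbf k)=\#\{j:k_j=i\}$, and write $\sum_{-\infty}^{i}l_j(\mathbf k)$ for the sum over all $j\in\mathbb Z\cup\{-\infty\}$ with $j\le i$ (the term $j=-\infty$ included). For $t>-1$ let $\mathsf P^{(t)}$ be the Markov kernel on $\{0,1,2,\dots\}$ given by $$\mathsf P^{(t)}(x_1,x_2)=\frac{p^{-x_2^2-tx_2}\,(p^{-1};p^{-1})_{x_1}(p^{-1-t};p^{-1})_{x_1}}{(p^{-1};p^{-1})_{x_2}(p^{-1};p^{-1})_{x_1-x_2}(p^{-1-t};p^{-1})_{x_2}}\quad\text{for }0\le x_2\le x_1,$$ and $\mathsf P^{(t)}(x_1,x_2)=0$ otherwise. For $0\le x\le N$ let $$\pi_N^{(s)}(x)=\frac{(p^{-1-s};p^{-1})_N^2\,(p^{-1};p^{-1})_N^2}{(p^{-1-s};p^{-1})_{2N}\,(p^{-1};p^{-1})_x^2\,(p^{-1};p^{-1})_{N-x}\,(p^{-1-s};p^{-1})_{N-x}}\,p^{-(N-x)^2-s(N-x)}.$$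 **Theorem.** $\pi_N^{(s)}$ is a probability measure on $\{0,1,\dots,N\}$. Moreover, a random $\mathbf k\in\Delta_N$ with law $\mathsf m_N^{(s)}$ (equivalently, the collection $\{l_i(\mathbf k)\}_{-\infty}^{\infty}$) can be sampled by the following procedure. 1. Sample $Y_0=\sum_{-\infty}^{0}l_j(\mathbf k)$ according to $\pi_N^{(s)}$. 2. Starting from $X_0=N-Y_0=N-\sum_{-\infty}^{0}l_j(\mathbf k)$, sample $X_i=N-\sum_{-\infty}^{i}l_j(\mathbf k)$, $i=1,2,3,\dots$, by running a Markov chain with transition kernel $\mathsf P^{(s)}$. 3. Starting from $Y_0$, sample $Y_i=\sum_{-\infty}^{-i}l_j(\mathbf k)$, $i=1,2,3,\dots$, by running a Markov chain with transition kernel $\mathsf P^{(0)}$. Given $Y_0$, the chains in steps 2 and 3 are independent. In detail: * If $\mathbf k$ has law $\mathsf m_N^{(s)}$, then the processes $X_i=N-\sum_{-\infty}^{i}l_j(\mathbf k)$ and $Y_i=\sum_{-\infty}^{-i}l_j(\mathbf k)$, $i\ge0$, have the joint law described by steps 1–3. * Conversely, if random sequences $X,Y$ on a probability space have the joint law described by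 steps 1–3, then almost surely there is exactly one $\mathbf k\in\Delta_N$ with $X_i=N-\sum_{-\infty}^{i}l_j(\mathbf k)$ and $Y_i=\sum_{-\infty}^{-i}l_j(\mathbf k)$ for all $i\ge0$; this $\mathbf k$ can be chosen as a random variable, and its law is $\mathsf m_N^{(s)}$. -/

import Mathlib

namespace PadicHua

open MeasureTheory

/-! ### The `q`-Pochhammer symbol, the kernel and the initial law -/

/-- The finite `q`-Pochhammer symbol `(a; q)_n = ∏_{j=0}^{n-1} (1 - a q^j)`. -/
noncomputable def qPoch (a q : ℝ) (n : ℕ) : ℝ :=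
  ∏ j ∈ Finset.range n, (1 - a * q ^ j)

/-- `(p⁻¹; p⁻¹)_n`. -/
noncomputable def poch (p n : ℕ) : ℝ :=
  qPoch ((p : ℝ)⁻¹) ((p : ℝ)⁻¹) n

/-- `(p^{-1-s}; p⁻¹)_n`. -/
noncomputable def pochS (p : ℕ) (s : ℝ) (n : ℕ) : ℝ :=
  qPoch ((p : ℝ) ^ (-1 - s)) ((p : ℝ)⁻¹) n

/-- The transition probabilities `P^{(s)}(x₁, x₂)` on the non-negative integers, equal to zero
unless `x₂ ≤ x₁`. -/
noncomputable def transition (p : ℕ) (s : ℝ) (x₁ x₂ : ℕ) : ℝ :=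
  if x₂ ≤ x₁ then
    (p : ℝ) ^ (-(x₂ : ℝ) ^ 2 - s * (x₂ : ℝ)) * poch p x₁ * pochS p s x₁ /
      (poch p x₂ * poch p (x₁ - x₂) * pochS p s x₂)
  else 0

/-- The weights `π_N^{(s)}(x)` for `0 ≤ x ≤ N`, extended by zero to `x > N`. -/
noncomputable def initialLaw (p N : ℕ) (s : ℝ) (x : ℕ) : ℝ :=
  if x ≤ N then
    pochS p s N ^ 2 * poch p N ^ 2 /
      (pochS p s (2 * N) * poch p x ^ 2 * poch p (N - x) * pochS p s (N - x)) *
      (p : ℝ) ^ (-((N : ℝ) - (x : ℝ)) ^ 2 - s * ((N : ℝ) - (x : ℝ)))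
  else 0

/-! ### Singular numbers of `p`-adic matrices -/

/-- The set `Δ_N` of tuples `k₁ ≥ k₂ ≥ ⋯ ≥ k_N` with entries in `ℤ ∪ {-∞}`. -/
def SingularTuple (N : ℕ) : Type :=
  {k : Fin N → WithBot ℤ // Antitone k}

/-- `Δ_N` is countable and discrete: every subset is measurable. -/
instance (N : ℕ) : MeasurableSpace (SingularTuple N) := ⊤

/-- The tuple `(-∞, …, -∞)`. -/
def SingularTuple.bot (N : ℕ) : SingularTuple N :=
  ⟨fun _ => ⊥, fun _ _ _ => le_rfl⟩

/-- `p^{-k}` for `k ∈ ℤ ∪ {-∞}`, with `p^{-(-∞)} = p^{∞} = 0` in `ℚ_p`. -/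
noncomputable def negPow (p : ℕ) [Fact p.Prime] : WithBot ℤ → ℚ_[p]
  | ⊥ => 0
  | (k : ℤ) => (p : ℚ_[p]) ^ (-k)

/-- `k` is a tuple of singular numbers of `Z`: we have `Z = B · diag(p^{-k₁}, …, p^{-k_N}) · C`
for some `B, C ∈ GL(N, ℤ_p)`. -/
def IsSingularTuple {p : ℕ} [Fact p.Prime] {N : ℕ}
    (Z : Matrix (Fin N) (Fin N) ℚ_[p]) (k : SingularTuple N) : Prop :=
  ∃ B C : GL (Fin N) ℤ_[p],
    Z = (B : Matrix (Fin N) (Fin N) ℤ_[p]).map (fun x => (x : ℚ_[p])) *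
        Matrix.diagonal (fun j => negPow p (k.1 j)) *
        (C : Matrix (Fin N) (Fin N) ℤ_[p]).map (fun x => (x : ℚ_[p]))

open Classical in
/-- The map `Sing_N`, sending a matrix to its singular numbers. Every matrix has exactly one tuple
of singular numbers, so the default value is never taken. -/
noncomputable def sing {p : ℕ} [Fact p.Prime] {N : ℕ}
    (Z : Matrix (Fin N) (Fin N) ℚ_[p]) : SingularTuple N :=
  if h : ∃ k, IsSingularTuple Z k then h.choose else SingularTuple.bot N

/-! ### The `p`-adic Hua measures -/

/-- The Borel `σ`-algebra of `Mat(N, ℚ_p) ≃ ℚ_p^{N²}`. -/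
noncomputable instance (p : ℕ) [Fact p.Prime] (N : ℕ) :
    MeasurableSpace (Matrix (Fin N) (Fin N) ℚ_[p]) := borel _

instance (p : ℕ) [Fact p.Prime] (N : ℕ) :
    BorelSpace (Matrix (Fin N) (Fin N) ℚ_[p]) := ⟨rfl⟩

/-- `Mat(N, ℤ_p)` as a compact subset of `Mat(N, ℚ_p)` with non-empty interior. -/
noncomputable def integerMatrices (p : ℕ) [Fact p.Prime] (N : ℕ) :
    TopologicalSpace.PositiveCompacts (Matrix (Fin N) (Fin N) ℚ_[p]) where
  carrier := {Z | ∀ i j, ‖Z i j‖ ≤ 1}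
  isCompact' := by
    have h : IsCompact (Set.pi Set.univ fun _ : Fin N =>
        Set.pi Set.univ fun _ : Fin N => Metric.closedBall (0 : ℚ_[p]) 1) :=
      isCompact_univ_pi fun _ => isCompact_univ_pi fun _ => isCompact_closedBall _ _
    have e : {Z : Matrix (Fin N) (Fin N) ℚ_[p] | ∀ i j, ‖Z i j‖ ≤ 1} =
        Set.pi Set.univ fun _ : Fin N =>
          Set.pi Set.univ fun _ : Fin N => Metric.closedBall (0 : ℚ_[p]) 1 := by
      refine Set.ext fun Z => ?_
      exact ⟨fun hZ i _ j _ => mem_closedBall_zero_iff.2 (hZ i j),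
        fun hZ i j => mem_closedBall_zero_iff.1 (hZ i trivial j trivial)⟩
    rw [e]
    exact h
  interior_nonempty' := by
    have h : IsOpen (Set.pi Set.univ fun _ : Fin N =>
        Set.pi Set.univ fun _ : Fin N => Metric.ball (0 : ℚ_[p]) 1) :=
      isOpen_set_pi Set.finite_univ fun _ _ =>
        isOpen_set_pi Set.finite_univ fun _ _ => Metric.isOpen_ball
    refine ⟨0, mem_interior.2 ⟨_, ?_, h, ?_⟩⟩
    · intro Z hZ i j
      have := hZ i trivial j trivial
      exact le_of_lt (by simpa using this)
    · intro i _ j _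
      simp

/-- The Haar measure `vol` on `Mat(N, ℚ_p)`, normalized by `vol(Mat(N, ℤ_p)) = 1`. -/
noncomputable def vol (p : ℕ) [Fact p.Prime] (N : ℕ) :
    Measure (Matrix (Fin N) (Fin N) ℚ_[p]) :=
  Measure.addHaarMeasure (integerMatrices p N)

/-- `γ(Z) = ∏_{k_j > 0} p^{k_j}`, where `k₁ ≥ ⋯ ≥ k_N` are the singular numbers of `Z`. -/
noncomputable def gam {p : ℕ} [Fact p.Prime] {N : ℕ}
    (Z : Matrix (Fin N) (Fin N) ℚ_[p]) : ℝ :=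
  ∏ j, if 0 < (sing Z).1 j then (p : ℝ) ^ (((sing Z).1 j).unbotD 0) else 1

/-- The `p`-adic Hua measure `M_N^{(s)}` on `Mat(N, ℚ_p)`. -/
noncomputable def huaMeasure (p : ℕ) [Fact p.Prime] (N : ℕ) (s : ℝ) :
    Measure (Matrix (Fin N) (Fin N) ℚ_[p]) :=
  (vol p N).withDensity fun Z =>
    ENNReal.ofReal (pochS p s N ^ 2 / pochS p s (2 * N) * gam Z ^ (-s - 2 * (N : ℝ)))

/-- The law `m_N^{(s)}` on `Δ_N` of the singular numbers of an `M_N^{(s)}`-distributed matrix. -/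
noncomputable def singularLaw (p : ℕ) [Fact p.Prime] (N : ℕ) (s : ℝ) :
    Measure (SingularTuple N) :=
  (huaMeasure p N s).map sing

/-! ### Counting functions and the sampling procedure -/

/-- `l_i(k) = #{j : k_j = i}` for `i ∈ ℤ ∪ {-∞}`. -/
def mult {N : ℕ} (k : SingularTuple N) (i : WithBot ℤ) : ℕ :=
  (Finset.univ.filter fun j => k.1 j = i).card

/-- `∑_{-∞}^{i} l_j(k)`, the finitely supported sum of `l_j(k)` over all `j ∈ ℤ ∪ {-∞}`
with `j ≤ i`. -/
noncomputable def cumul {N : ℕ} (k : SingularTuple N) (i : ℤ) : ℕ :=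
  ∑ᶠ (j : WithBot ℤ) (_ : j ≤ (i : WithBot ℤ)), mult k j

/-- The process `i ↦ N - ∑_{-∞}^{i} l_j(k)`, `i = 0, 1, 2, …`. -/
noncomputable def upper {N : ℕ} (k : SingularTuple N) (i : ℕ) : ℕ :=
  N - cumul k (i : ℤ)

/-- The process `i ↦ ∑_{-∞}^{-i} l_j(k)`, `i = 0, 1, 2, …`. -/
noncomputable def lower {N : ℕ} (k : SingularTuple N) (i : ℕ) : ℕ :=
  cumul k (-(i : ℤ))

/-- The `ℕ`-valued processes `X` and `Y` are produced by the following procedure: `Y 0` is drawn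
from `π_N^{(s)}`; then `X 0 = N - Y 0`; and, given `Y 0`, the sequences `X` and `Y` are run as
independent Markov chains started from `N - Y 0` and `Y 0`, with transition kernels `P^{(s)}` and
`P^{(0)}` respectively. -/
structure IsTwoChainSample (p N : ℕ) (s : ℝ) {Ω : Type*} [MeasurableSpace Ω] (μ : Measure Ω)
    (X Y : ℕ → Ω → ℕ) : Prop where
  measurable_X : ∀ i, Measurable (X i)
  measurable_Y : ∀ i, Measurable (Y i)
  init : ∀ x, μ {ω | Y 0 ω = x} = ENNReal.ofReal (initialLaw p N s x)
  start : ∀ᵐ ω ∂μ, X 0 ω = N - Y 0 ω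
  run : ∀ (n : ℕ) (a b : ℕ → ℕ), a 0 = N - b 0 →
    μ {ω | ∀ i ≤ n, X i ω = a i ∧ Y i ω = b i} =
      μ {ω | Y 0 ω = b 0} *
        ((∏ i ∈ Finset.range n, ENNReal.ofReal (transition p s (a i) (a (i + 1)))) *
          ∏ i ∈ Finset.range n, ENNReal.ofReal (transition p 0 (b i) (b (i + 1))))

end PadicHua

namespace PadicHua

open MeasureTheory

set_option linter.unusedSectionVars false

/-! ### The kernel as a rational function of `q = p⁻¹` and `u = p^{-s}` -/

/-! Everything rests on the law of a Haar-uniform matrix `A` over `ℤ_p`. Let `depth i A` be the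
number of invariant factors divisible by `p ^ i`. For uniform `A` of size `n`, the sequence `depth 0
A, depth 1 A, …` is a Markov chain with kernel `P^{(0)}` started at `n` (`haarInt_depth`). The
corank of `A` modulo `p` has law `P^{(0)}(n, ·)`, by counting matrices of given rank over `𝔽_p`
(`card_filter_corank`). Given the residue class, `A` splits, up to invertible factors, into a unit
block and a block divisible by `p`. The Schur complement of the unit block, divided by `p`, is again
uniform (`haarInt_preimage_schur`), and passing to it lowers every depth index by one
(`depth_succ_fromBlocks`).

A matrix with all singular numbers at most `m` is `p^{-m} A` with `A` integral, and then `cumul k (m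
- n) = depth n A` (`cumul_eq_depth`). The depth chain therefore runs through the `X` process
backwards in time and then through the `Y` process. The density is constant along a path, because `γ
= ∏ p^{X_i}` (`gam_eq_prod`). A detailed-balance identity between `P^{(0)}`, `P^{(s)}` and
`π_N^{(s)}` (`pow_mul_transition_zero`) telescopes, reverses time on the `X` side, and converts the
product of weights into `π_N^{(s)}(b_0) ∏ P^{(s)} ∏ P^{(0)}`. This treats paths with `X_m = 0`. The
restriction is removed by letting `m → ∞`, since the `P^{(s)}` chain is absorbed at `0` with
probability one (`tendsto_absorbed`).

That `P^{(s)}` and `π_N^{(s)}` have total mass one are the cases `z = 0` and `z = q^N` of a single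
`q`-Chu–Vandermonde type summation (`sum_qKernel_mul_prod`), where `q = p⁻¹`. For the converse, the
events that a run of the procedure equals the path of a given `k` are countably many and disjoint,
and have probabilities `m_N^{(s)}({k})`. These add up to one, so almost every run comes from exactly
one `k`. -/

theorem qPoch_zero (a q : ℝ) : qPoch a q 0 = 1 := by simp [qPoch]

theorem qPoch_succ (a q : ℝ) (n : ℕ) : qPoch a q (n + 1) = qPoch a q n * (1 - a * q ^ n) := by
  simp [qPoch, Finset.prod_range_succ]

theorem qPoch_succ' (a q : ℝ) (n : ℕ) : qPoch a q (n + 1) = (1 - a) * qPoch (a * q) q n := by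
  simp only [qPoch, Finset.prod_range_succ', pow_zero, mul_one, pow_succ']
  rw [mul_comm]
  simp only [mul_assoc]

theorem qPoch_add (a q : ℝ) (m n : ℕ) :
    qPoch a q (m + n) = qPoch a q m * ∏ j ∈ Finset.range n, (1 - a * q ^ (m + j)) := by
  simp [qPoch, Finset.prod_range_add]

theorem qPoch_pos {a q : ℝ} (ha : 0 < a) (ha1 : a < 1) (hq : 0 < q) (hq1 : q < 1) (n : ℕ) :
    0 < qPoch a q n := by
  refine Finset.prod_pos fun j _ => ?_
  have : a * q ^ j ≤ a * 1 := by
    gcongr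
    exact pow_le_one₀ hq.le hq1.le
  linarith

/-- The transition probabilities in terms of `q` and `u`. -/
noncomputable def qKernel (q u : ℝ) (x y : ℕ) : ℝ :=
  if y ≤ x then
    q ^ (y ^ 2) * u ^ y * qPoch q q x * qPoch (u * q) q x /
      (qPoch q q y * qPoch q q (x - y) * qPoch (u * q) q y)
  else 0

theorem qKernel_of_lt {q u : ℝ} {x y : ℕ} (h : x < y) : qKernel q u x y = 0 :=
  if_neg (by omega)

section
variable {q u : ℝ} (hq : 0 < q) (hq1 : q < 1) (hu : 0 < u) (hu1 : u * q < 1)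
include hq hq1

theorem qPoch_self_pos (n : ℕ) : 0 < qPoch q q n := qPoch_pos hq hq1 hq hq1 n

omit hq hq1 in
theorem qKernel_add (u : ℝ) (y d : ℕ) : qKernel q u (y + d) y =
    q ^ (y ^ 2) * u ^ y * qPoch q q (y + d) * qPoch (u * q) q (y + d) /
      (qPoch q q y * qPoch q q d * qPoch (u * q) q y) := by
  simp [qKernel]

include hu hu1

theorem qPoch_mul_pos (n : ℕ) : 0 < qPoch (u * q) q n :=
  qPoch_pos (by positivity) hu1 hq hq1 n

theorem qKernel_nonneg (x y : ℕ) : 0 ≤ qKernel q u x y := by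
  unfold qKernel
  split_ifs
  · have h1 := (qPoch_self_pos hq hq1 x).le
    have h2 := (qPoch_self_pos hq hq1 y).le
    have h3 := (qPoch_self_pos hq hq1 (x - y)).le
    have h4 := (qPoch_mul_pos hq hq1 hu hu1 x).le
    have h5 := (qPoch_mul_pos hq hq1 hu hu1 y).le
    positivity
  · exact le_rfl

theorem qKernel_self (x : ℕ) : qKernel q u x x = q ^ (x ^ 2) * u ^ x := by
  have h1 := (qPoch_self_pos hq hq1 x).ne'
  have h2 := (qPoch_mul_pos hq hq1 hu hu1 x).ne'
  have := qKernel_add (q := q) u x 0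
  rw [add_zero] at this
  rw [this, qPoch_zero]
  field_simp

omit hu hu1 in
theorem qKernel_zero_right (x : ℕ) : qKernel q u x 0 = qPoch (u * q) q x := by
  have h1 := (qPoch_self_pos hq hq1 x).ne'
  simp [qKernel, qPoch_zero]
  field_simp

omit hu hu1 in
theorem qKernel_succ_zero (x : ℕ) :
    qKernel q u (x + 1) 0 = (1 - u * q) * qKernel q (u * q) x 0 := by
  rw [qKernel_zero_right hq hq1, qKernel_zero_right hq hq1,
    qPoch_succ']

/-- A `q`-Pascal rule. For `y < x`, after division by the left side it becomes `q^{y+1}(1 - q^{x-y})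
+ (1 - q^{y+1}) = 1 - q^{x+1}`. The parameter moves from `u` to `u q`, because `(uq; q)_{x+1} = (1 -
uq) (uq²; q)_x`. -/
theorem qKernel_succ_succ (x y : ℕ) : qKernel q u (x + 1) (y + 1) =
    (1 - u * q ^ (y + 2)) * qKernel q (u * q) x (y + 1) +
      u * q ^ (y + 1) * qKernel q (u * q) x y := by
  have huq : 0 < u * q := by positivity
  have huq1 : u * q * q < 1 := by nlinarith
  rcases lt_trichotomy x y with h | h | h
  · rw [qKernel_of_lt (by omega), qKernel_of_lt (by omega), qKernel_of_lt h]; ring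
  · subst h
    rw [qKernel_self hq hq1 hu hu1, qKernel_self hq hq1 huq huq1, qKernel_of_lt (by omega)]
    ring
  · obtain ⟨d, rfl⟩ : ∃ d, x = y + 1 + d := ⟨x - (y + 1), by omega⟩
    rw [show y + 1 + d + 1 = y + 1 + (d + 1) by ring, qKernel_add, qKernel_add,
      show y + 1 + d = y + (d + 1) by ring, qKernel_add,
      show y + 1 + (d + 1) = y + (d + 1) + 1 by ring,
      qPoch_succ' (u * q) q (y + (d + 1)), qPoch_succ' (u * q) q y, qPoch_succ q q (y + (d + 1)),
      qPoch_succ q q d, qPoch_succ q q y, qPoch_succ (u * q * q) q y]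
    have a1 := (qPoch_self_pos hq hq1 y).ne'
    have a2 := (qPoch_self_pos hq hq1 d).ne'
    have a3 := (qPoch_mul_pos hq hq1 huq huq1 y).ne'
    have b (n : ℕ) : q * q ^ n < 1 := by
      rw [← pow_succ']; exact pow_lt_one₀ hq.le hq1 (by omega)
    have b1 : 1 - q * q ^ y ≠ 0 := by linarith [b y]
    have b2 : 1 - q * q ^ d ≠ 0 := by linarith [b d]
    have b3 : 1 - u * q * q * q ^ y ≠ 0 := by
      have : u * q * q * q ^ y ≤ u * q * q * 1 := by
        gcongr; exact pow_le_one₀ hq.le hq1.le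
      linarith
    have b4 : 1 - u * q ≠ 0 := by linarith
    rw [show (y + 1) ^ 2 = y ^ 2 + y + y + 1 by ring]
    simp only [pow_add, mul_pow, pow_one]
    generalize q ^ y = Y at *
    generalize q ^ d = D at *
    generalize qPoch (u * q * q) q (y + (d + 1)) = Z1
    generalize qPoch q q (y + (d + 1)) = Z2
    generalize qPoch (u * q * q) q y = Z3 at *
    generalize h1 : 1 - q * Y = c1 at *
    generalize h2 : 1 - q * D = c2 at *
    generalize h3 : 1 - u * q * q * Y = c3 at *
    generalize h4 : 1 - u * q = c4 at *
    field_simp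
    subst h1 h2 h3
    ring

end

/-- Induction on `x` through the `q`-Pascal rule, for all `u` at once since the rule changes `u`.
The free parameter `z` lets one identity normalize both the kernel and the initial law. -/
theorem sum_qKernel_mul_prod (x : ℕ) : ∀ {q u : ℝ} (_ : 0 < q) (_ : q < 1) (_ : 0 < u)
    (_ : u * q < 1) (z : ℝ),
    ∑ a ∈ Finset.range (x + 1), qKernel q u x a * ∏ i ∈ Finset.range a, (1 - z * (q⁻¹) ^ i) =
      ∏ j ∈ Finset.range x, (1 - z * u * q ^ (j + 1)) := by
  induction x with
  | zero =>
    intro q u hq hq1 hu hu1 z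
    simp [qKernel, qPoch_zero]
  | succ x ih =>
    intro q u hq hq1 hu hu1 z
    set w : ℕ → ℝ := fun a => ∏ i ∈ Finset.range a, (1 - z * (q⁻¹) ^ i) with hw
    have hw1 (a : ℕ) : w (a + 1) = w a * (1 - z * (q⁻¹) ^ a) := by
      simp [hw, Finset.prod_range_succ]
    have key := ih hq hq1 (u := u * q) (by positivity) (by nlinarith) z
    rw [Finset.sum_range_succ', Finset.prod_range_succ']
    have e : ∏ j ∈ Finset.range x, (1 - z * u * q ^ (j + 1 + 1)) =
        ∏ j ∈ Finset.range x, (1 - z * (u * q) * q ^ (j + 1)) :=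
      Finset.prod_congr rfl fun j _ => by ring
    rw [e, ← key, Finset.sum_mul]
    have s1 : ∑ a ∈ Finset.range (x + 1), qKernel q u (x + 1) (a + 1) * w (a + 1) =
        ∑ a ∈ Finset.range (x + 1), (1 - u * q ^ (a + 2)) * qKernel q (u * q) x (a + 1) * w (a + 1)
        + ∑ a ∈ Finset.range (x + 1), u * q ^ (a + 1) * qKernel q (u * q) x a * w (a + 1) := by
      rw [← Finset.sum_add_distrib]
      exact Finset.sum_congr rfl fun a _ => by rw [qKernel_succ_succ hq hq1 hu hu1]; ring
    -- Shifting the index puts both halves of the recursion over the same `qKernel q (u * q) x a`;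
    -- the term `a = x + 1` thereby added is zero.
    have s2 : ∑ a ∈ Finset.range (x + 1), (1 - u * q ^ (a + 2)) * qKernel q (u * q) x (a + 1)
          * w (a + 1) + (1 - u * q) * qKernel q (u * q) x 0 * w 0 =
        ∑ a ∈ Finset.range (x + 1), (1 - u * q ^ (a + 1)) * qKernel q (u * q) x a * w a := by
      have := Finset.sum_range_succ'
        (fun a => (1 - u * q ^ (a + 1)) * qKernel q (u * q) x a * w a) (x + 1)
      rw [Finset.sum_range_succ, qKernel_of_lt (Nat.lt_succ_self x)] at this
      simp only [zero_add, pow_one, mul_zero, zero_mul, add_zero] at this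
      rw [this]
    rw [s1, qKernel_succ_zero hq hq1, add_right_comm, s2, ← Finset.sum_add_distrib]
    -- The coefficient `(1 - u q^{a+1}) + u q^{a+1} (1 - z q^{-a})` equals `1 - z u q`,
    -- independently of `a`, and is the remaining factor of the product.
    refine Finset.sum_congr rfl fun a _ => ?_
    rw [hw1]
    have : q ^ a * (q⁻¹) ^ a = 1 := by rw [← mul_pow, mul_inv_cancel₀ hq.ne', one_pow]
    simp only [zero_add, pow_succ]
    linear_combination (-u * q * qKernel q (u * q) x a * w a * z) * this

theorem sum_qKernel {q u : ℝ} (hq : 0 < q) (hq1 : q < 1) (hu : 0 < u) (hu1 : u * q < 1) (x : ℕ) :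
    ∑ a ∈ Finset.range (x + 1), qKernel q u x a = 1 := by
  simpa using sum_qKernel_mul_prod x hq hq1 hu hu1 0

/-! ### The transition kernel and the initial law -/

section
variable {p : ℕ} [hp : Fact p.Prime] {s : ℝ}

theorem inv_prime_pos : 0 < ((p : ℝ)⁻¹) := by
  have := hp.out.pos; positivity

theorem inv_prime_lt_one : ((p : ℝ)⁻¹) < 1 :=
  inv_lt_one_of_one_lt₀ (by exact_mod_cast hp.out.one_lt)

theorem rpow_neg_pos : 0 < ((p : ℝ) ^ (-s)) := by
  have := hp.out.pos; positivity

theorem rpow_neg_mul_inv : (p : ℝ) ^ (-s) * (p : ℝ)⁻¹ = (p : ℝ) ^ (-1 - s) := by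
  have : 0 < (p : ℝ) := by exact_mod_cast hp.out.pos
  rw [← Real.rpow_neg_one (p : ℝ), ← Real.rpow_add this]; ring_nf

theorem rpow_neg_mul_inv_lt_one (hs : -1 < s) : (p : ℝ) ^ (-s) * (p : ℝ)⁻¹ < 1 := by
  rw [rpow_neg_mul_inv]
  exact Real.rpow_lt_one_of_one_lt_of_neg (by exact_mod_cast hp.out.one_lt) (by linarith)

theorem pochS_eq (n : ℕ) : pochS p s n = qPoch ((p : ℝ) ^ (-s) * (p : ℝ)⁻¹) (p : ℝ)⁻¹ n := by
  rw [pochS, rpow_neg_mul_inv]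

theorem rpow_quadratic (x : ℕ) :
    (p : ℝ) ^ (-(x : ℝ) ^ 2 - s * x) = ((p : ℝ)⁻¹) ^ (x ^ 2) * ((p : ℝ) ^ (-s)) ^ x := by
  have h : 0 < (p : ℝ) := by exact_mod_cast hp.out.pos
  rw [← Real.rpow_natCast (_ ^ (-s)), ← Real.rpow_mul h.le, inv_pow, ← Real.rpow_natCast (p : ℝ) (x ^ 2),
    ← Real.rpow_neg h.le, ← Real.rpow_add h]
  congr 1
  push_cast
  ring

theorem transition_eq (x y : ℕ) :
    transition p s x y = qKernel (p : ℝ)⁻¹ ((p : ℝ) ^ (-s)) x y := by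
  simp only [transition, qKernel, rpow_quadratic, pochS_eq, poch]

theorem poch_pos (n : ℕ) : 0 < poch p n := qPoch_self_pos inv_prime_pos inv_prime_lt_one n

theorem pochS_pos (hs : -1 < s) (n : ℕ) : 0 < pochS p s n := by
  rw [pochS_eq]
  exact qPoch_mul_pos inv_prime_pos inv_prime_lt_one rpow_neg_pos (rpow_neg_mul_inv_lt_one hs) n

omit hp in
theorem transition_of_lt {x y : ℕ} (h : x < y) : transition p s x y = 0 := if_neg (by omega)

theorem transition_nonneg (hs : -1 < s) (x y : ℕ) : 0 ≤ transition p s x y := by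
  rw [transition_eq]
  exact qKernel_nonneg inv_prime_pos inv_prime_lt_one rpow_neg_pos (rpow_neg_mul_inv_lt_one hs) x y

theorem sum_transition (hs : -1 < s) (x : ℕ) :
    ∑ y ∈ Finset.range (x + 1), transition p s x y = 1 := by
  simp only [transition_eq]
  exact sum_qKernel inv_prime_pos inv_prime_lt_one rpow_neg_pos (rpow_neg_mul_inv_lt_one hs) x

theorem transition_self_lt_one (hs : -1 < s) {x : ℕ} (hx : x ≠ 0) : transition p s x x < 1 := by
  rw [transition_eq, qKernel_self inv_prime_pos inv_prime_lt_one rpow_neg_pos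
    (rpow_neg_mul_inv_lt_one hs), ← rpow_quadratic]
  apply Real.rpow_lt_one_of_one_lt_of_neg (by exact_mod_cast hp.out.one_lt)
  have : (1 : ℝ) ≤ x := by exact_mod_cast Nat.one_le_iff_ne_zero.2 hx
  nlinarith

theorem initialLaw_nonneg (hs : -1 < s) (N x : ℕ) : 0 ≤ initialLaw p N s x := by
  unfold initialLaw
  split_ifs
  · have := hp.out.pos
    have h2 := (poch_pos (p := p) (N - x)).le
    have h3 := (pochS_pos (p := p) hs (2 * N)).le
    have h4 := (pochS_pos (p := p) hs (N - x)).le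
    positivity
  · exact le_rfl

/-- Writes the initial law as a reweighted row of `P^{(s)}`, which brings its total mass within
reach of `sum_qKernel_mul_prod`; `poch_div_poch` identifies the weight with the case `z = q^N`. -/
theorem initialLaw_sub (hs : -1 < s) {N a : ℕ} (ha : a ≤ N) : initialLaw p N s (N - a) =
    transition p s N a * (poch p N / poch p (N - a)) * (pochS p s N / pochS p s (2 * N)) := by
  have e : (N : ℝ) - ((N - a : ℕ) : ℝ) = a := by push_cast [ha]; ring
  rw [initialLaw, if_pos (by omega), transition, if_pos ha, e, Nat.sub_sub_self ha]
  have h1 := (poch_pos (p := p) N).ne'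
  have h2 := (poch_pos (p := p) (N - a)).ne'
  have h2 := (poch_pos (p := p) a).ne'
  have h3 := (pochS_pos (p := p) hs (2 * N)).ne'
  have h4 := (pochS_pos (p := p) hs N).ne'
  have h4 := (pochS_pos (p := p) hs a).ne'
  field_simp

theorem poch_div_poch {N a : ℕ} (ha : a ≤ N) : poch p N / poch p (N - a) =
    ∏ i ∈ Finset.range a, (1 - (p : ℝ)⁻¹ ^ N * ((p : ℝ)⁻¹)⁻¹ ^ i) := by
  have hq : ((p : ℝ)⁻¹) ≠ 0 := (inv_prime_pos (p := p)).ne'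
  induction a with
  | zero => simp [(poch_pos (p := p) N).ne']
  | succ a ih =>
    have h1 : poch p (N - a) = poch p (N - (a + 1)) * (1 - (p : ℝ)⁻¹ ^ (N - a)) := by
      rw [show N - a = N - (a + 1) + 1 by omega, poch, qPoch_succ, ← pow_succ']; rfl
    have h2 := (poch_pos (p := p) (N - a)).ne'
    have h3 := (poch_pos (p := p) (N - (a + 1))).ne'
    have h4 : (p : ℝ)⁻¹ ^ N * ((p : ℝ)⁻¹)⁻¹ ^ a = (p : ℝ)⁻¹ ^ (N - a) := by
      rw [inv_pow _ a, pow_sub₀ _ hq (by omega)]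
    rw [Finset.prod_range_succ, ← ih (by omega), h4, h1]
    rw [h1] at h2
    have h5 := right_ne_zero_of_mul h2
    generalize (p : ℝ)⁻¹ ^ (N - a) = t at *
    field_simp

theorem sum_initialLaw (hs : -1 < s) (N : ℕ) :
    ∑ x ∈ Finset.range (N + 1), initialLaw p N s x = 1 := by
  rw [← Finset.sum_range_reflect]
  have h1 : ∀ a ∈ Finset.range (N + 1), initialLaw p N s (N + 1 - 1 - a) =
      qKernel (p : ℝ)⁻¹ ((p : ℝ) ^ (-s)) N a *
        (∏ i ∈ Finset.range a, (1 - (p : ℝ)⁻¹ ^ N * ((p : ℝ)⁻¹)⁻¹ ^ i)) *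
        (pochS p s N / pochS p s (2 * N)) := fun a ha => by
    have ha : a ≤ N := by simpa [Nat.lt_succ_iff] using ha
    rw [Nat.add_sub_cancel, initialLaw_sub hs ha, poch_div_poch ha, transition_eq]
  rw [Finset.sum_congr rfl h1, ← Finset.sum_mul,
    sum_qKernel_mul_prod N inv_prime_pos inv_prime_lt_one rpow_neg_pos (rpow_neg_mul_inv_lt_one hs)]
  have h2 : pochS p s (2 * N) = pochS p s N *
      ∏ j ∈ Finset.range N, (1 - (p : ℝ)⁻¹ ^ N * (p : ℝ) ^ (-s) * (p : ℝ)⁻¹ ^ (j + 1)) := by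
    rw [pochS_eq, pochS_eq, two_mul, qPoch_add]
    congr 1
    exact Finset.prod_congr rfl fun j _ => by ring
  have h3 := (pochS_pos (p := p) hs (2 * N)).ne'
  rw [← mul_div_assoc, div_eq_one_iff_eq h3, h2, mul_comm]

/-! ### Absorption at zero -/

/-- The probability that the chain with kernel `P^{(s)}` started from `x` is at `0` at time `m`. -/
noncomputable def absorbed (p : ℕ) (s : ℝ) : ℕ → ℕ → ℝ
  | 0, x => if x = 0 then 1 else 0
  | m + 1, x => ∑ y ∈ Finset.range (x + 1), transition p s x y * absorbed p s m y

theorem absorbed_nonneg (hs : -1 < s) (m x : ℕ) : 0 ≤ absorbed p s m x := by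
  induction m generalizing x with
  | zero => simp only [absorbed]; split_ifs <;> norm_num
  | succ m ih => exact Finset.sum_nonneg fun y _ => mul_nonneg (transition_nonneg hs x y) (ih y)

theorem absorbed_le_one (hs : -1 < s) (m x : ℕ) : absorbed p s m x ≤ 1 := by
  induction m generalizing x with
  | zero => simp only [absorbed]; split_ifs <;> norm_num
  | succ m ih =>
    rw [← sum_transition (p := p) hs x]
    exact Finset.sum_le_sum fun y _ =>
      mul_le_of_le_one_right (transition_nonneg hs x y) (ih y)

theorem absorbed_zero (hs : -1 < s) (m : ℕ) : absorbed p s m 0 = 1 := by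
  induction m with
  | zero => simp [absorbed]
  | succ m ih => simpa [absorbed, ih] using sum_transition (p := p) hs 0

theorem absorbed_le_succ (hs : -1 < s) (m x : ℕ) : absorbed p s m x ≤ absorbed p s (m + 1) x := by
  induction m generalizing x with
  | zero =>
    rcases Nat.eq_zero_or_pos x with rfl | hx
    · rw [absorbed_zero hs, absorbed_zero hs]
    · have : absorbed p s 0 x = 0 := if_neg (by omega)
      rw [this]
      exact absorbed_nonneg hs _ _
  | succ m ih =>
    exact Finset.sum_le_sum fun y _ => mul_le_mul_of_nonneg_left (ih y) (transition_nonneg hs x y)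

/-- The absorption probabilities increase in `m` and are bounded, so they converge to a harmonic
function `l` with `l 0 = 1`. If `l = 1` below `x`, harmonicity gives `(1 - P(x,x)) (l x - 1) = 0`,
and `P(x,x) < 1` for `x ≠ 0`. -/
theorem tendsto_absorbed (hs : -1 < s) (x : ℕ) :
    Filter.Tendsto (fun m => absorbed p s m x) Filter.atTop (nhds 1) := by
  have hex : ∀ x, ∃ l, Filter.Tendsto (fun m => absorbed p s m x) Filter.atTop (nhds l) :=
    fun x => ⟨_, tendsto_atTop_ciSup (monotone_nat_of_le_succ fun m => absorbed_le_succ (p := p) hs m x)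
      ⟨1, by rintro _ ⟨m, rfl⟩; exact absorbed_le_one hs m x⟩⟩
  choose l hl using hex
  have hrec (x : ℕ) : l x = ∑ y ∈ Finset.range (x + 1), transition p s x y * l y :=
    tendsto_nhds_unique ((Filter.tendsto_add_atTop_iff_nat 1).2 (hl x))
      (tendsto_finsetSum _ fun y _ => (hl y).const_mul _)
  suffices h : l x = 1 by rw [← h]; exact hl x
  induction x using Nat.strong_induction_on with
  | _ x ih =>
    rcases Nat.eq_zero_or_pos x with rfl | hx
    · refine tendsto_nhds_unique (hl 0) ?_
      simp only [absorbed_zero hs]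
      exact tendsto_const_nhds
    · have h1 := hrec x
      have h2 := sum_transition (p := p) hs x
      rw [Finset.sum_range_succ] at h1 h2
      have h3 : ∑ y ∈ Finset.range x, transition p s x y * l y =
          ∑ y ∈ Finset.range x, transition p s x y :=
        Finset.sum_congr rfl fun y hy => by rw [ih y (Finset.mem_range.1 hy), mul_one]
      have h4 := transition_self_lt_one (p := p) hs hx.ne'
      have h5 : (1 - transition p s x x) * (l x - 1) = 0 := by
        rw [h3] at h1
        linear_combination h1 + h2
      rcases mul_eq_zero.1 h5 with h | h <;> linarith

/-- Passing from the integral matrix process to the upper process: one step. -/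
theorem pow_mul_transition_zero (hs : -1 < s) {N a b : ℕ} (hba : b ≤ a) (ha : a ≤ N) :
    (p : ℝ) ^ (N ^ 2) * (p : ℝ) ^ (-(s + 2 * N) * a) * transition p 0 (N - b) (N - a) *
        initialLaw p N s (N - b) =
      transition p s a b * initialLaw p N s (N - a) := by
  have hp0 : 0 < (p : ℝ) := by exact_mod_cast hp.out.pos
  have hb : b ≤ N := hba.trans ha
  have eab : N - b - (N - a) = a - b := by omega
  have hz (n : ℕ) : pochS p 0 n = poch p n := by
    rw [pochS, poch, sub_zero, Real.rpow_neg_one]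
  rw [initialLaw, if_pos (Nat.sub_le _ _), initialLaw, if_pos (Nat.sub_le _ _), transition,
    if_pos (by omega), transition, if_pos hba, eab, hz, hz, Nat.sub_sub_self ha,
    Nat.sub_sub_self hb]
  have h1 := (poch_pos (p := p) N).ne'
  have h2 := (poch_pos (p := p) (N - a)).ne'
  have h2 := (poch_pos (p := p) (N - b)).ne'
  have h2 := (poch_pos (p := p) (a - b)).ne'
  have h2 := (poch_pos (p := p) a).ne'
  have h2 := (poch_pos (p := p) b).ne'
  have h3 := (pochS_pos (p := p) hs (2 * N)).ne'
  have h4 := (pochS_pos (p := p) hs N).ne'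
  have h4 := (pochS_pos (p := p) hs a).ne'
  have h4 := (pochS_pos (p := p) hs b).ne'
  -- All Pochhammer factors match; what is left is `N² - (s + 2N) a - (N - a)² = -a² - s a`. The
  -- exponent `-s - 2N` of the density and the volume factor `p^{N²}` complete the square.
  have e : (p : ℝ) ^ (N ^ 2) * (p : ℝ) ^ (-(s + 2 * N) * a) *
      (p : ℝ) ^ (-((N - a : ℕ) : ℝ) ^ 2 - 0 * ((N - a : ℕ) : ℝ)) *
      (p : ℝ) ^ (-((N : ℝ) - (N - b : ℕ)) ^ 2 - s * ((N : ℝ) - (N - b : ℕ))) =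
      (p : ℝ) ^ (-(b : ℝ) ^ 2 - s * (b : ℝ)) *
      (p : ℝ) ^ (-((N : ℝ) - (N - a : ℕ)) ^ 2 - s * ((N : ℝ) - (N - a : ℕ))) := by
    rw [← Real.rpow_natCast, ← Real.rpow_add hp0, ← Real.rpow_add hp0, ← Real.rpow_add hp0,
      ← Real.rpow_add hp0]
    push_cast [ha, hb]
    ring_nf
  generalize (p : ℝ) ^ (N ^ 2) = x1 at *
  generalize (p : ℝ) ^ (-(s + 2 * N) * a) = x2 at *
  generalize (p : ℝ) ^ (-((N - a : ℕ) : ℝ) ^ 2 - 0 * ((N - a : ℕ) : ℝ)) = x3 at *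
  generalize (p : ℝ) ^ (-((N : ℝ) - (N - b : ℕ)) ^ 2 - s * ((N : ℝ) - (N - b : ℕ))) = x4 at *
  generalize (p : ℝ) ^ (-(b : ℝ) ^ 2 - s * (b : ℝ)) = x5 at *
  generalize (p : ℝ) ^ (-((N : ℝ) - (N - a : ℕ)) ^ 2 - s * ((N : ℝ) - (N - a : ℕ))) = x6 at *
  field_simp
  linear_combination e
end

/-! ### Matrices over `ℤ_p` -/

section
variable {p : ℕ} [hp : Fact p.Prime] {ι κ : Type*} [Fintype ι] [DecidableEq ι] [Fintype κ]
  [DecidableEq κ]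

/-- Reduction of a vector modulo `p`. -/
noncomputable def reduceVec (x : ι → ℤ_[p]) : ι → ZMod p := PadicInt.toZMod ∘ x

theorem toZMod_eq_zero_iff (x : ℤ_[p]) : PadicInt.toZMod x = 0 ↔ (p : ℤ_[p]) ∣ x := by
  rw [← RingHom.mem_ker, PadicInt.ker_toZMod, PadicInt.maximalIdeal_eq_span_p,
    Ideal.mem_span_singleton]

theorem isUnit_iff_toZMod_ne_zero (x : ℤ_[p]) : IsUnit x ↔ PadicInt.toZMod x ≠ 0 := by
  rw [Ne, toZMod_eq_zero_iff, ← PadicInt.norm_lt_one_iff_dvd, PadicInt.isUnit_iff, not_lt]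
  exact ⟨fun h => h.ge, fun h => le_antisymm (PadicInt.norm_le_one x) h⟩

theorem exists_reduceVec (v : ι → ZMod p) : ∃ x : ι → ℤ_[p], reduceVec x = v :=
  ⟨fun i => (ZMod.ringHom_surjective PadicInt.toZMod (v i)).choose,
    funext fun i => (ZMod.ringHom_surjective PadicInt.toZMod (v i)).choose_spec⟩

theorem dvd_of_norm_le {x y : ℤ_[p]} (h : ‖y‖ ≤ ‖x‖) : x ∣ y := by
  rcases eq_or_ne x 0 with rfl | hx
  · rw [norm_zero, norm_le_zero_iff] at h
    rw [h]
  · rw [PadicInt.norm_eq_zpow_neg_valuation hx, PadicInt.norm_le_pow_iff_mem_span_pow,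
      Ideal.mem_span_singleton] at h
    rw [PadicInt.unitCoeff_spec hx]
    simpa using h

/-- The image in `𝔽_p^ι` of the lattice of all `x ∈ ℤ_p^ι` with `A x ∈ p^n ℤ_p^ι`. -/
noncomputable def depthSpace (n : ℕ) (A : Matrix ι ι ℤ_[p]) : Submodule (ZMod p) (ι → ZMod p) where
  carrier := {v | ∃ x y : ι → ℤ_[p], A.mulVec x = (p : ℤ_[p]) ^ n • y ∧ reduceVec x = v}
  add_mem' := by
    rintro _ _ ⟨x, y, h, rfl⟩ ⟨x', y', h', rfl⟩
    refine ⟨x + x', y + y', by rw [Matrix.mulVec_add, h, h', smul_add], ?_⟩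
    ext i
    simp [reduceVec]
  zero_mem' := ⟨0, 0, by simp, by ext i; simp [reduceVec]⟩
  smul_mem' := by
    rintro c _ ⟨x, y, h, rfl⟩
    obtain ⟨c, rfl⟩ := ZMod.ringHom_surjective (PadicInt.toZMod (p := p)) c
    refine ⟨c • x, c • y, by rw [Matrix.mulVec_smul, h, smul_comm], ?_⟩
    ext i
    simp [reduceVec]

/-- The number of invariant factors of `A` divisible by `p ^ n`. -/
noncomputable def depth (n : ℕ) (A : Matrix ι ι ℤ_[p]) : ℕ :=
  Module.finrank (ZMod p) (depthSpace n A)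

/-! ### Invariance and computation of the depth. -/

theorem finrank_le_of_injOn {F V W : Type*} [Field F] [AddCommGroup V] [Module F V]
    [AddCommGroup W] [Module F W] [Module.Finite F W] {S : Submodule F V} {S' : Submodule F W}
    (T : V →ₗ[F] W) (h : ∀ v ∈ S, T v ∈ S') (hinj : ∀ v ∈ S, T v = 0 → v = 0) :
    Module.finrank F S ≤ Module.finrank F S' := by
  refine LinearMap.finrank_le_finrank_of_injective (f := T.restrict h) ?_
  rw [injective_iff_map_eq_zero]
  rintro ⟨v, hv⟩ h0
  have : T v = 0 := congrArg Subtype.val h0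
  exact Subtype.ext (hinj v hv this)

theorem reduceVec_mulVec (A : Matrix ι ι ℤ_[p]) (x : ι → ℤ_[p]) :
    reduceVec (A.mulVec x) = (A.map PadicInt.toZMod).mulVec (reduceVec x) :=
  funext fun i => RingHom.map_mulVec _ _ _ i

theorem depth_le_mul_left (n : ℕ) (b A : Matrix ι ι ℤ_[p]) : depth n A ≤ depth n (b * A) := by
  refine Submodule.finrank_mono ?_
  rintro _ ⟨x, y, h, rfl⟩
  exact ⟨x, b.mulVec y, by rw [← Matrix.mulVec_mulVec, h, Matrix.mulVec_smul], rfl⟩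

theorem depth_mul_right_le (n : ℕ) (A c : Matrix ι ι ℤ_[p]) (hc : IsUnit c) :
    depth n (A * c) ≤ depth n A := by
  refine finrank_le_of_injOn (Matrix.mulVecLin (c.map PadicInt.toZMod)) ?_ ?_
  · rintro _ ⟨x, y, h, rfl⟩
    exact ⟨c.mulVec x, y, by rw [Matrix.mulVec_mulVec, h], reduceVec_mulVec c x⟩
  · intro v _ hv
    have h1 : IsUnit (c.map (PadicInt.toZMod (p := p))) := hc.map PadicInt.toZMod.mapMatrix
    obtain ⟨u, hu⟩ := h1
    rw [← hu] at hv
    have := congrArg ((↑u⁻¹ : Matrix ι ι (ZMod p)).mulVec) hv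
    simpa [Matrix.mulVec_mulVec] using this

/-- Left multiplication acts only on the image `y` and right multiplication by a unit is injective
modulo `p`, so each gives one inequality; applying them also to the inverses gives equality. -/
theorem depth_mul_mul (n : ℕ) (A : Matrix ι ι ℤ_[p]) {b c : Matrix ι ι ℤ_[p]} (hb : IsUnit b)
    (hc : IsUnit c) : depth n (b * A * c) = depth n A := by
  obtain ⟨b, rfl⟩ := hb
  obtain ⟨c, rfl⟩ := hc
  apply le_antisymm
  · have := depth_le_mul_left n (↑b⁻¹ : Matrix ι ι ℤ_[p]) ((b : Matrix ι ι ℤ_[p]) * A)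
    rw [← mul_assoc, Units.inv_mul, one_mul] at this
    exact (depth_mul_right_le n _ _ c.isUnit).trans this
  · have := depth_mul_right_le n ((b : Matrix ι ι ℤ_[p]) * A * (c : Matrix ι ι ℤ_[p])) (↑c⁻¹ : Matrix ι ι ℤ_[p]) (Units.isUnit _)
    rw [mul_assoc, Units.mul_inv, mul_one] at this
    exact (depth_le_mul_left n _ _).trans this

theorem depth_submatrix_le (n : ℕ) (A : Matrix ι ι ℤ_[p]) (e : κ ≃ ι) :
    depth n (A.submatrix e e) ≤ depth n A := by
  refine finrank_le_of_injOn (LinearMap.funLeft (ZMod p) (ZMod p) e.symm) ?_ ?_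
  · rintro _ ⟨x, y, h, rfl⟩
    refine ⟨x ∘ e.symm, y ∘ e.symm, ?_, rfl⟩
    rw [Matrix.submatrix_mulVec_equiv] at h
    have := congrArg (· ∘ e.symm) h
    simp only [Function.comp_assoc, Equiv.self_comp_symm, Function.comp_id] at this
    exact this
  · intro v _ hv
    exact LinearMap.funLeft_injective_of_surjective _ _ _ e.symm.surjective
      (hv.trans (map_zero _).symm)

theorem depth_submatrix (n : ℕ) (A : Matrix ι ι ℤ_[p]) (e : κ ≃ ι) :
    depth n (A.submatrix e e) = depth n A := by
  refine le_antisymm (depth_submatrix_le n A e) ?_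
  simpa using depth_submatrix_le n (A.submatrix e e) e.symm

/-- If `p ^ n` does not divide `d j`, then `d j * x j ∈ p ^ n ℤ_p` forces `x j` to vanish modulo
`p`; the other coordinates are unconstrained. Restriction to the latter and extension by zero give
the two inequalities. -/
theorem depth_diagonal (n : ℕ) (d : ι → ℤ_[p]) :
    depth n (Matrix.diagonal d) = Nat.card {j // (p : ℤ_[p]) ^ n ∣ d j} := by
  have hcard : Module.finrank (ZMod p) (({j // (p : ℤ_[p]) ^ n ∣ d j}) → ZMod p) =
      Nat.card {j // (p : ℤ_[p]) ^ n ∣ d j} := by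
    classical
    rw [Module.finrank_pi, Nat.card_eq_fintype_card]
  rw [← hcard, ← finrank_top]
  apply le_antisymm
  · refine finrank_le_of_injOn (LinearMap.funLeft (ZMod p) (ZMod p) Subtype.val)
      (fun _ _ => Submodule.mem_top) ?_
    rintro _ ⟨x, y, h, rfl⟩ h0
    ext j
    by_cases hj : (p : ℤ_[p]) ^ n ∣ d j
    · exact congrFun h0 ⟨j, hj⟩
    · by_contra hne
      have hu : IsUnit (x j) := (isUnit_iff_toZMod_ne_zero _).2 hne
      have := congrFun h j
      rw [Matrix.mulVec_diagonal, Pi.smul_apply, smul_eq_mul] at this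
      exact hj (hu.dvd_mul_right.1 (this ▸ dvd_mul_right _ _))
  · classical
    refine finrank_le_of_injOn (Function.ExtendByZero.linearMap (ZMod p) Subtype.val) ?_ ?_
    · intro v _
      obtain ⟨x, rfl⟩ := exists_reduceVec v
      have hdvd (j : {j // (p : ℤ_[p]) ^ n ∣ d j}) := j.2
      choose y hy using hdvd
      refine ⟨Function.extend Subtype.val x 0,
        Function.extend Subtype.val (fun j => y j * x j) 0, ?_, ?_⟩
      · ext1 j
        rw [Matrix.mulVec_diagonal]
        by_cases hj : (p : ℤ_[p]) ^ n ∣ d j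
        · have e : j = Subtype.val (⟨j, hj⟩ : {j // (p : ℤ_[p]) ^ n ∣ d j}) := rfl
          rw [Pi.smul_apply]
          rw [e, Subtype.val_injective.extend_apply, Subtype.val_injective.extend_apply]
          rw [hy, smul_eq_mul, mul_assoc]
        · have : ¬ ∃ a : {j // (p : ℤ_[p]) ^ n ∣ d j}, a.val = j := by
            rintro ⟨a, rfl⟩
            exact hj a.2
          rw [Pi.smul_apply, Function.extend_apply' _ _ _ this, Function.extend_apply' _ _ _ this]
          simp
      · ext j
        simp only [reduceVec, Function.comp_apply, Function.ExtendByZero.linearMap_apply]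
        by_cases hj : (p : ℤ_[p]) ^ n ∣ d j
        · have e : j = Subtype.val (⟨j, hj⟩ : {j // (p : ℤ_[p]) ^ n ∣ d j}) := rfl
          rw [e, Subtype.val_injective.extend_apply, Subtype.val_injective.extend_apply]
          rfl
        · have : ¬ ∃ a : {j // (p : ℤ_[p]) ^ n ∣ d j}, a.val = j := by
            rintro ⟨a, rfl⟩
            exact hj a.2
          rw [Function.extend_apply' _ _ _ this, Function.extend_apply' _ _ _ this]
          simp
    · intro v _ hv
      ext j
      have := congrFun hv j.val
      rwa [Function.ExtendByZero.linearMap_apply, Subtype.val_injective.extend_apply] at this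

theorem depth_zero (A : Matrix ι ι ℤ_[p]) : depth 0 A = Fintype.card ι := by
  have : depthSpace 0 A = ⊤ := by
    rw [eq_top_iff]
    rintro v -
    obtain ⟨x, rfl⟩ := exists_reduceVec v
    exact ⟨x, A.mulVec x, by simp, rfl⟩
  rw [depth, this, finrank_top, Module.finrank_pi]

/-- The Schur complement removes the unit block and shifts the depth by one. -/
theorem depth_succ_fromBlocks (n : ℕ) {A : Matrix ι ι ℤ_[p]} (hA : IsUnit A)
    (B : Matrix ι κ ℤ_[p]) (C : Matrix κ ι ℤ_[p]) (E : Matrix κ κ ℤ_[p]) :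
    depth (n + 1) (Matrix.fromBlocks A ((p : ℤ_[p]) • B) ((p : ℤ_[p]) • C) ((p : ℤ_[p]) • E)) =
      depth n (E - (p : ℤ_[p]) • (C * A⁻¹ * B)) := by
  have hdet : IsUnit A.det := (Matrix.isUnit_iff_isUnit_det A).1 hA
  have hp0 : (p : ℤ_[p]) ≠ 0 := PadicInt.prime_p.ne_zero
  have hpz : (PadicInt.toZMod (p : ℤ_[p])) = 0 := by simp
  apply le_antisymm
  · refine finrank_le_of_injOn (LinearMap.funLeft (ZMod p) (ZMod p) Sum.inr) ?_ ?_
    · rintro _ ⟨x, y, h, rfl⟩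
      obtain ⟨x1, x2, rfl⟩ : ∃ x1 x2, x = Sum.elim x1 x2 := ⟨_, _, (Sum.elim_comp_inl_inr x).symm⟩
      obtain ⟨y1, y2, rfl⟩ : ∃ y1 y2, y = Sum.elim y1 y2 := ⟨_, _, (Sum.elim_comp_inl_inr y).symm⟩
      have h1 : A.mulVec x1 + (p : ℤ_[p]) • B.mulVec x2 = (p : ℤ_[p]) ^ (n + 1) • y1 := by
        ext i
        simpa [Matrix.fromBlocks_mulVec, Matrix.smul_mulVec] using congrFun h (Sum.inl i)
      have h2 : C.mulVec x1 + E.mulVec x2 = (p : ℤ_[p]) ^ n • y2 := by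
        ext i
        apply mul_left_cancel₀ hp0
        have := congrFun h (Sum.inr i)
        simp [Matrix.fromBlocks_mulVec, Matrix.smul_mulVec] at this
        simp only [Pi.add_apply, Pi.smul_apply, smul_eq_mul]
        rw [mul_add, this]
        ring
      -- The witness results from solving the first block row for `x1` and substituting into the
      -- second.
      refine ⟨x2, y2 - (p : ℤ_[p]) • (C * A⁻¹).mulVec y1, ?_, rfl⟩
      have h3 : x1 = (p : ℤ_[p]) ^ (n + 1) • A⁻¹.mulVec y1 -
          (p : ℤ_[p]) • (A⁻¹ * B).mulVec x2 := by
        have := congrArg A⁻¹.mulVec h1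
        rw [Matrix.mulVec_add, Matrix.mulVec_mulVec, Matrix.nonsing_inv_mul _ hdet,
          Matrix.one_mulVec, Matrix.mulVec_smul, Matrix.mulVec_smul, Matrix.mulVec_mulVec] at this
        rw [← this, add_sub_cancel_right]
      rw [Matrix.sub_mulVec, Matrix.smul_mulVec, smul_sub, ← h2, h3, Matrix.mulVec_sub,
        Matrix.mulVec_smul, Matrix.mulVec_smul, Matrix.mulVec_mulVec, Matrix.mulVec_mulVec,
        ← Matrix.mul_assoc, smul_smul, pow_succ]
      abel
    · rintro _ ⟨x, y, h, rfl⟩ h0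
      -- The first block row makes `A x1` divisible by `p`, and `A` is invertible. Thus the first
      -- block of coordinates vanishes modulo `p` and forgetting it is injective.
      have hx1 : ∀ i, PadicInt.toZMod (x (Sum.inl i)) = 0 := by
        have h1 : A.mulVec (x ∘ Sum.inl) = (p : ℤ_[p]) • ((p : ℤ_[p]) ^ n • (y ∘ Sum.inl) -
            B.mulVec (x ∘ Sum.inr)) := by
          ext i
          have := congrFun h (Sum.inl i)
          simp [Matrix.fromBlocks_mulVec, Matrix.smul_mulVec] at this
          simp only [Pi.smul_apply, Pi.sub_apply, smul_eq_mul, Function.comp_apply]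
          linear_combination this
        have h2 := congrArg A⁻¹.mulVec h1
        rw [Matrix.mulVec_mulVec, Matrix.nonsing_inv_mul _ hdet, Matrix.one_mulVec,
          Matrix.mulVec_smul] at h2
        intro i
        have := congrFun h2 i
        simp only [Function.comp_apply, Pi.smul_apply, smul_eq_mul] at this
        rw [this, map_mul, hpz, zero_mul]
      ext j
      rcases j with i | i
      · exact hx1 i
      · exact congrFun h0 i
  · set T : (κ → ZMod p) →ₗ[ZMod p] (ι ⊕ κ → ZMod p) :=
      { toFun := fun v => Sum.elim 0 v
        map_add' := fun v w => by ext (i | i) <;> simp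
        map_smul' := fun c v => by ext (i | i) <;> simp } with hT
    refine finrank_le_of_injOn T ?_ ?_
    · rintro _ ⟨x, y, h, rfl⟩
      -- The first component is chosen to annihilate the first block row exactly; being a multiple
      -- of `p`, it disappears in the reduction.
      refine ⟨Sum.elim (-(p : ℤ_[p]) • (A⁻¹ * B).mulVec x) x, Sum.elim 0 y, ?_, ?_⟩
      · rw [Matrix.sub_mulVec, Matrix.smul_mulVec] at h
        have h1 : A.mulVec ((A⁻¹ * B).mulVec x) = B.mulVec x := by
          rw [Matrix.mulVec_mulVec, ← Matrix.mul_assoc, Matrix.mul_nonsing_inv _ hdet,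
            Matrix.one_mul]
        rw [Matrix.mul_assoc, ← Matrix.mulVec_mulVec] at h
        rw [Matrix.fromBlocks_mulVec]
        ext (i | i)
        · simp [Matrix.smul_mulVec, Matrix.mulVec_neg, Matrix.mulVec_smul, h1]
        · have := congrFun h i
          simp only [Pi.sub_apply, Pi.smul_apply, smul_eq_mul, Matrix.mulVec_mulVec] at this
          simp [Matrix.smul_mulVec, Matrix.mulVec_neg, Matrix.mulVec_smul]
          linear_combination (p : ℤ_[p]) * this
      · ext (i | i) <;> simp [hT, reduceVec]
    · intro v _ hv
      ext i
      exact congrFun hv (Sum.inr i)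

/-! ### Diagonalization over `ℤ_p` -/

/-- `A = b * diagonal d * c` with invertible `b`, `c`. -/
def IsDiagonalizable (A : Matrix ι ι ℤ_[p]) : Prop :=
  ∃ b c : Matrix ι ι ℤ_[p], IsUnit b ∧ IsUnit c ∧ ∃ d, A = b * Matrix.diagonal d * c

theorem IsDiagonalizable.of_submatrix {A : Matrix ι ι ℤ_[p]} (e f : κ ≃ ι)
    (h : IsDiagonalizable (A.submatrix e f)) : IsDiagonalizable A := by
  obtain ⟨b, c, hb, hc, d, h⟩ := h
  refine ⟨b.submatrix e.symm e.symm, c.submatrix e.symm f.symm,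
    (Matrix.isUnit_submatrix_equiv _ _).2 hb, (Matrix.isUnit_submatrix_equiv _ _).2 hc,
    d ∘ e.symm, ?_⟩
  have h1 : A = (A.submatrix e f).submatrix e.symm f.symm := by simp
  have h2 : Matrix.diagonal (d ∘ e.symm) = (Matrix.diagonal d).submatrix e.symm e.symm := by
    rw [Matrix.submatrix_diagonal_equiv]
  rw [h1, h, h2, Matrix.submatrix_mul_equiv, Matrix.submatrix_mul_equiv]

/-- Gaussian elimination over a valuation ring: an entry of maximal norm divides all entries, so as
a pivot it clears its row and column. -/
theorem isDiagonalizable_fin (n : ℕ) (A : Matrix (Fin n) (Fin n) ℤ_[p]) : IsDiagonalizable A := by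
  induction n with
  | zero => exact ⟨1, 1, isUnit_one, isUnit_one, 0, Subsingleton.elim _ _⟩
  | succ n ih =>
    obtain ⟨⟨i, j⟩, hmax⟩ := Finite.exists_max fun ij : Fin (n + 1) × Fin (n + 1) => ‖A ij.1 ij.2‖
    let e0 : Unit ⊕ Fin n ≃ Fin (n + 1) := Fintype.equivOfCardEq (by simp [add_comm])
    let e : Unit ⊕ Fin n ≃ Fin (n + 1) := e0.trans (Equiv.swap (e0 (Sum.inl ())) i)
    let f : Unit ⊕ Fin n ≃ Fin (n + 1) := e0.trans (Equiv.swap (e0 (Sum.inl ())) j)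
    have hei : e (Sum.inl ()) = i := by simp [e]
    have hfj : f (Sum.inl ()) = j := by simp [f]
    refine IsDiagonalizable.of_submatrix e f ?_
    have hdvd (k l) : A i j ∣ A k l := dvd_of_norm_le (hmax (k, l))
    choose g hg using hdvd
    set a := A i j
    let v : Matrix Unit (Fin n) ℤ_[p] := Matrix.of fun _ k => g i (f (Sum.inr k))
    let w : Matrix (Fin n) Unit ℤ_[p] := Matrix.of fun k _ => g (e (Sum.inr k)) j
    let X : Matrix (Fin n) (Fin n) ℤ_[p] := Matrix.of fun k l => A (e (Sum.inr k)) (f (Sum.inr l))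
    have hA : A.submatrix e f = Matrix.fromBlocks (Matrix.diagonal fun _ => a) (a • v) (a • w) X := by
      ext (k | k) (l | l)
      · simp [hei, hfj, a]
      · simp [hei, v, ← hg]
      · simp [hfj, w, ← hg]
      · simp [X]
    -- This is the Schur complement of the pivot: the pivot row and column are `a • v` and `a • w`,
    -- so no division by `a` is needed, even for `a = 0`.
    obtain ⟨b, c, hb, hc, d, h⟩ := ih (X - a • (w * v))
    refine ⟨Matrix.fromBlocks 1 0 w 1 * Matrix.fromBlocks 1 0 0 b,
      Matrix.fromBlocks 1 0 0 c * Matrix.fromBlocks 1 v 0 1, ?_, ?_, Sum.elim (fun _ => a) d, ?_⟩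
    · exact (Matrix.isUnit_fromBlocks_zero₁₂.2 ⟨isUnit_one, isUnit_one⟩).mul
        (Matrix.isUnit_fromBlocks_zero₁₂.2 ⟨isUnit_one, hb⟩)
    · exact (Matrix.isUnit_fromBlocks_zero₂₁.2 ⟨isUnit_one, hc⟩).mul
        (Matrix.isUnit_fromBlocks_zero₂₁.2 ⟨isUnit_one, isUnit_one⟩)
    · have hd : (Matrix.diagonal fun _ : Unit => a) = a • (1 : Matrix Unit Unit ℤ_[p]) := by
        rw [Matrix.smul_one_eq_diagonal]
      have hX : X = b * Matrix.diagonal d * c + a • (w * v) := by rw [← h]; abel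
      rw [hA, ← Matrix.fromBlocks_diagonal, hd]
      simp only [Matrix.fromBlocks_multiply, Matrix.mul_zero, Matrix.zero_mul, add_zero, zero_add,
        Matrix.one_mul, Matrix.mul_one, Matrix.mul_smul, Matrix.smul_mul]
      rw [hX]
      congr 1
      simp only [Matrix.mul_assoc]
      abel

theorem isDiagonalizable (A : Matrix ι ι ℤ_[p]) : IsDiagonalizable A :=
  IsDiagonalizable.of_submatrix (Fintype.equivFin ι).symm (Fintype.equivFin ι).symm
    (isDiagonalizable_fin _ _)

end

/-! ### Counting matrices of given rank over a finite field -/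

section
variable {F V : Type*} [Field F] [Fintype F] [AddCommGroup V] [Module F V] [Fintype V]

open Classical in
/-- The number of `m`-tuples of vectors spanning a space of dimension `k`. -/
noncomputable def spanCount (F V : Type*) [Field F] [AddCommGroup V] [Module F V] [Fintype V]
    (m k : ℕ) : ℝ :=
  ∑ v : Fin m → V, if Module.finrank F (Submodule.span F (Set.range v)) = k then 1 else 0

-- A new vector lies in `S` for `|F|^{dim S}` choices and otherwise raises the dimension by one.
-- This is the single step of the rank recursion in `spanCount_succ`.
open Classical in
theorem sum_finrank_insert (S : Submodule F V) (k : ℕ) :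
    (∑ x : V, if Module.finrank F (S ⊔ Submodule.span F {x} : Submodule F V) = k then (1 : ℝ) else 0) =
      (if Module.finrank F S = k then (Fintype.card F : ℝ) ^ k else 0) +
      (if Module.finrank F S + 1 = k then (Fintype.card F : ℝ) ^ Module.finrank F V -
        (Fintype.card F : ℝ) ^ (Module.finrank F S) else 0) := by
  have h1 (x : V) : (if Module.finrank F (S ⊔ Submodule.span F {x} : Submodule F V) = k
      then (1 : ℝ) else 0) = (if x ∈ S then (if Module.finrank F S = k then 1 else 0)
        else (if Module.finrank F S + 1 = k then 1 else 0)) := by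
    by_cases hx : x ∈ S
    · rw [if_pos hx, sup_eq_left.2 ((Submodule.span_singleton_le_iff_mem x S).2 hx)]
    · rw [if_neg hx, Submodule.finrank_sup_span_singleton hx]
  have h2 : ((Finset.univ.filter fun x : V => x ∈ S).card : ℝ) =
      (Fintype.card F : ℝ) ^ Module.finrank F S := by
    rw [← Nat.cast_pow, ← Module.card_eq_pow_finrank, Fintype.card_subtype]
  have h3 : ((Finset.univ.filter fun x : V => x ∉ S).card : ℝ) =
      (Fintype.card F : ℝ) ^ Module.finrank F V - (Fintype.card F : ℝ) ^ Module.finrank F S := by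
    rw [← h2, ← Nat.cast_pow, ← Module.card_eq_pow_finrank, eq_sub_iff_add_eq, ← Nat.cast_add,
      add_comm, Finset.card_filter_add_card_filter_not, Finset.card_univ]
  rw [Finset.sum_congr rfl fun x _ => h1 x, Finset.sum_ite, Finset.sum_const, Finset.sum_const,
    nsmul_eq_mul, nsmul_eq_mul, h2, h3]
  split_ifs with a b b
  · omega
  · rw [a]; ring
  · ring
  · ring

theorem spanCount_succ (m k : ℕ) : spanCount F V (m + 1) k =
    (Fintype.card F : ℝ) ^ k * spanCount F V m k +
      if k = 0 then 0 else ((Fintype.card F : ℝ) ^ Module.finrank F V -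
        (Fintype.card F : ℝ) ^ (k - 1)) * spanCount F V m (k - 1) := by
  classical
  have hsum (g : (Fin (m + 1) → V) → ℝ) :
      ∑ v, g v = ∑ v : Fin m → V, ∑ x : V, g (Fin.cons x v) := by
    rw [← (Fin.consEquiv fun _ : Fin (m + 1) => V).sum_comp, Fintype.sum_prod_type_right]
    rfl
  have h (v : Fin m → V) (x : V) :
      Module.finrank F (Submodule.span F (Set.range (Fin.cons x v : Fin (m + 1) → V))) =
        Module.finrank F (Submodule.span F (Set.range v) ⊔ Submodule.span F {x} : Submodule F V) := by
    rw [Fin.range_cons, Submodule.span_insert, sup_comm]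
  rw [spanCount, hsum]
  simp only [h, sum_finrank_insert, Finset.sum_add_distrib, spanCount, Finset.mul_sum]
  congr 1
  · exact Finset.sum_congr rfl fun v _ => by split_ifs <;> simp
  · split_ifs with hk
    · exact Finset.sum_eq_zero fun v _ => if_neg (by omega)
    · refine Finset.sum_congr rfl fun v _ => ?_
      split_ifs with a b b
      · rw [← a]; simp
      · omega
      · omega
      · simp

omit [Fintype F] in
theorem spanCount_zero (k : ℕ) : spanCount F V 0 k = if k = 0 then 1 else 0 := by
  have h (v : Fin 0 → V) : Module.finrank F (Submodule.span F (Set.range v)) = 0 := by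
    rw [Set.range_eq_empty, Submodule.span_empty, finrank_bot]
  simp only [spanCount, h, eq_comm (a := k)]
  simp

theorem spanCount_of_lt {m k : ℕ} (h : m < k) : spanCount F V m k = 0 := by
  induction m generalizing k with
  | zero => rw [spanCount_zero, if_neg (by omega)]
  | succ m ih => rw [spanCount_succ, ih (by omega), ih (by omega)]; simp

/-- The closed form satisfies the recursion `spanCount_succ`. Writing the length as `k + e` and the
dimension as `k + f` avoids truncated subtraction. -/
theorem spanCount_add {q : ℝ} (hq : q = (Fintype.card F : ℝ)⁻¹) (k e f : ℕ)
    (hf : Module.finrank F V = k + f) :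
    spanCount F V (k + e) k = (Fintype.card F : ℝ) ^ (k * (k + e + f)) * qPoch q q (k + f) *
      qPoch q q (k + e) / (qPoch q q f * qPoch q q e * qPoch q q k) := by
  have hc : (1 : ℝ) < Fintype.card F := by exact_mod_cast Fintype.one_lt_card
  have hq0 : 0 < q := by rw [hq]; positivity
  have hq1 : q < 1 := by rw [hq]; exact inv_lt_one_of_one_lt₀ hc
  have hP (n : ℕ) : qPoch q q n ≠ 0 := (qPoch_pos hq0 hq1 hq0 hq1 n).ne'
  have hb (n : ℕ) : 1 - q * q ^ n ≠ 0 := by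
    have : q * q ^ n < 1 := by rw [← pow_succ']; exact pow_lt_one₀ hq0.le hq1 (by omega)
    linarith
  obtain ⟨m, hm⟩ : ∃ m, m = k + e := ⟨_, rfl⟩
  obtain ⟨c, hcd⟩ : ∃ c : ℝ, c = Fintype.card F := ⟨_, rfl⟩
  rw [← hcd] at hq hc ⊢
  have hcq (n : ℕ) : c ^ n * q ^ n = 1 := by
    rw [← mul_pow, hq, mul_inv_cancel₀ (by positivity), one_pow]
  have hc0 : c ≠ 0 := by positivity
  induction m generalizing k e f with
  | zero =>
    obtain ⟨rfl, rfl⟩ : k = 0 ∧ e = 0 := by omega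
    rw [spanCount_zero, if_pos rfl]
    simp [qPoch_zero, hP]
  | succ m ih =>
    rcases k with _ | k
    · obtain rfl : e = m + 1 := by omega
      have := ih 0 m f hf (by omega)
      simp only [zero_add, zero_mul, pow_zero, one_mul, qPoch_zero, mul_one] at this ⊢
      rw [spanCount_succ, this]
      have h1 := hP f
      have h2 := hP m
      have h3 := hP (m + 1)
      simp
      field_simp
    · have hfin : Module.finrank F V = k + (f + 1) := by omega
      have h2 := ih k e (f + 1) hfin (by omega)
      rw [show k + 1 + e = (k + e) + 1 by ring, spanCount_succ, ← hcd, if_neg (by omega),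
        Nat.add_sub_cancel, h2, hf]
      have a1 := hP f
      have a2 := hP k
      have b1 := hb f
      have b2 := hb k
      have q1 : c ^ (k + 1 + f) - c ^ k = c ^ (k + 1 + f) * (1 - q * q ^ f) := by
        linear_combination c ^ k * hcq (f + 1)
      -- For `e = 0` the shorter tuple has too few vectors to span dimension `k + 1`, so only the
      -- term that raises the dimension survives.
      rcases e with _ | e
      · rw [spanCount_of_lt (by omega), mul_zero, zero_add, q1]
        rw [show k + (f + 1) = k + f + 1 by ring, show k + 1 + f = k + f + 1 by ring]
        simp only [add_zero, qPoch_succ]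
        simp only [qPoch_zero]
        rw [show (k + 1) * (k + f + 1) = k * (k + (f + 1)) + (k + f + 1) by ring, pow_add c (k * (k + (f + 1)))]
        field_simp
      · have h1 := ih (k + 1) e f hf (by omega)
        rw [show k + (e + 1) = k + 1 + e by ring, h1, q1]
        rw [show k + (f + 1) = k + f + 1 by ring, show k + 1 + f = k + f + 1 by ring,
          show k + 1 + e = k + e + 1 by ring]
        simp only [qPoch_succ]
        have a3 := hP e
        have b3 := hb e
        have b4 := hb (k + e)
        have b5 := hb (k + e + 1)
        rw [show (k + 1) * (k + e + 1 + 1 + f) = k * (k + e + 1 + (f + 1)) + (k + f + 1) + (e + 1)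
            by ring,
          show (k + 1) * (k + e + 1 + f) = k * (k + e + 1 + (f + 1)) + f + (e + 1) by ring]
        have hce : c ^ (e + 1) = (q * q ^ e)⁻¹ := by
          rw [← pow_succ']; exact eq_inv_of_mul_eq_one_left (hcq (e + 1))
        simp only [pow_add c _ (e + 1), hce]
        have hq' := hq0.ne'
        clear ih h1 h2 q1 hcq hce hm
        generalize k * (k + e + 1 + (f + 1)) = K
        simp only [pow_add, pow_one]
        simp only [pow_add, pow_one] at b5 b4
        generalize qPoch q q f = Pf at *
        generalize qPoch q q k = Pk at *
        generalize qPoch q q e = Pe at *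
        generalize qPoch q q (k + e) = Pke at *
        generalize qPoch q q (k + f) = Pkf at *
        have hqe : q ^ e ≠ 0 := by positivity
        generalize q ^ e = Qe at *
        generalize q ^ k = Qk at *
        generalize q ^ f = Qf at *
        generalize g1 : 1 - q * Qe = c1 at *
        generalize g2 : 1 - q * Qk = c2 at *
        generalize g3 : 1 - q * Qf = c3 at *
        field_simp
        subst g1 g2 g3
        ring
end

/-- This is where the kernel `P^{(0)}` enters: `P^{(0)}(n, ·)` is the law of the corank of a uniform
`n × n` matrix over `𝔽_p`. The count is `spanCount` of the rows, with `e = f = y` and `k = n - y`.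
-/
theorem card_filter_corank (p : ℕ) [hp : Fact p.Prime] (ι : Type*) [Fintype ι] [DecidableEq ι]
    (y : ℕ) :
    ((Finset.univ.filter fun A : Matrix ι ι (ZMod p) => Fintype.card ι - A.rank = y).card : ℝ) =
      (p : ℝ) ^ (Fintype.card ι ^ 2) * transition p 0 (Fintype.card ι) y := by
  classical
  obtain ⟨n, hn⟩ : ∃ n, n = Fintype.card ι := ⟨_, rfl⟩
  rw [← hn]
  rcases lt_or_ge n y with h | h
  · rw [transition_of_lt h, mul_zero, Nat.cast_eq_zero, Finset.card_eq_zero,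
      Finset.filter_eq_empty_iff]
    intro A _
    omega
  obtain ⟨k, rfl⟩ : ∃ k, n = k + y := ⟨n - y, by omega⟩
  have hrank (A : Matrix ι ι (ZMod p)) : k + y - A.rank = y ↔ A.rank = k := by
    have := A.rank_le_card_width
    omega
  let e : ι ≃ Fin (k + y) := Fintype.equivFinOfCardEq hn.symm
  let E : (Fin (k + y) → ι → ZMod p) ≃ Matrix ι ι (ZMod p) :=
    (Equiv.arrowCongr e.symm (Equiv.refl _)).trans Matrix.of
  have hE (v : Fin (k + y) → ι → ZMod p) : (E v).rank =
      Module.finrank (ZMod p) (Submodule.span (ZMod p) (Set.range v)) := by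
    have : Set.range (E v).row = Set.range v := by
      rw [← e.surjective.range_comp v]
      rfl
    rw [Matrix.rank_eq_finrank_span_row, this]
  have hcount : ((Finset.univ.filter fun A : Matrix ι ι (ZMod p) => k + y - A.rank = y).card : ℝ) =
      spanCount (ZMod p) (ι → ZMod p) (k + y) k := by
    rw [Finset.card_filter, Nat.cast_sum, ← E.sum_comp, spanCount]
    refine Finset.sum_congr rfl fun v _ => ?_
    simp only [hrank]
    simp only [hE, Nat.cast_ite, Nat.cast_one, Nat.cast_zero]
  have hz (n : ℕ) : pochS p 0 n = poch p n := by
    rw [pochS, poch, sub_zero, Real.rpow_neg_one]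
  have hp0 : (p : ℝ) ≠ 0 := by exact_mod_cast hp.out.ne_zero
  rw [hcount, spanCount_add (q := (p : ℝ)⁻¹) (by rw [ZMod.card]) k y y
    (by rw [Module.finrank_pi]; exact hn.symm), transition, if_pos h, ZMod.card, hz, hz,
    rpow_quadratic, neg_zero, Real.rpow_zero, one_pow, mul_one, Nat.add_sub_cancel]
  have h1 : (p : ℝ) ^ (k * (k + y + y)) = (p : ℝ) ^ ((k + y) ^ 2) * (p : ℝ)⁻¹ ^ (y ^ 2) := by
    rw [show (k + y) ^ 2 = k * (k + y + y) + y ^ 2 by ring, pow_add, inv_pow, mul_assoc,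
      mul_inv_cancel₀ (by positivity), mul_one]
  have a1 := (poch_pos (p := p) y).ne'
  have a2 := (poch_pos (p := p) k).ne'
  rw [h1]
  unfold poch at a1 a2 ⊢
  field_simp

/-! ### Haar measure on `Mat(ι, ℤ_p)` -/

section
variable {p : ℕ} [hp : Fact p.Prime] {ι κ : Type*} [Fintype ι] [DecidableEq ι] [Fintype κ]
  [DecidableEq κ]

instance : CompactSpace (Matrix ι ι ℤ_[p]) := inferInstanceAs (CompactSpace (ι → ι → ℤ_[p]))

instance : SecondCountableTopology (Matrix ι ι ℤ_[p]) :=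
  inferInstanceAs (SecondCountableTopology (ι → ι → ℤ_[p]))

/-- The Borel `σ`-algebra of `Mat(ι, ℤ_p)`. -/
noncomputable instance : MeasurableSpace (Matrix ι ι ℤ_[p]) := borel _

instance : BorelSpace (Matrix ι ι ℤ_[p]) := ⟨rfl⟩

/-- The Haar probability measure on `Mat(ι, ℤ_p)`. -/
noncomputable def haarInt (p : ℕ) [Fact p.Prime] (ι : Type*) [Fintype ι] [DecidableEq ι] :
    Measure (Matrix ι ι ℤ_[p]) :=
  Measure.addHaarMeasure ⊤

instance : IsProbabilityMeasure (haarInt p ι) :=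
  ⟨by
    rw [haarInt]
    simpa using Measure.addHaarMeasure_self (K₀ := (⊤ : TopologicalSpace.PositiveCompacts
    (Matrix ι ι ℤ_[p])))⟩

instance : (haarInt p ι).IsAddLeftInvariant := by unfold haarInt; infer_instance

theorem eq_smul_haarInt (ν : Measure (Matrix ι ι ℤ_[p])) [IsFiniteMeasure ν]
    [ν.IsAddLeftInvariant] : ν = ν Set.univ • haarInt p ι := by
  rw [haarInt]
  simpa using Measure.addHaarMeasure_unique ν ⊤

theorem eq_haarInt (ν : Measure (Matrix ι ι ℤ_[p])) [IsProbabilityMeasure ν]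
    [ν.IsAddLeftInvariant] : ν = haarInt p ι := by
  rw [eq_smul_haarInt ν, measure_univ, one_smul]

/-- A measurable embedding of `Mat(ι, ℤ_p)` compatible with translations carries the Haar measure
to a multiple of any left-invariant measure. -/
theorem measure_image_eq {G : Type*} [AddGroup G] [MeasurableSpace G] [MeasurableAdd G]
    (ν : Measure G) [ν.IsAddLeftInvariant] {φ : Matrix ι ι ℤ_[p] → G} (hφ : MeasurableEmbedding φ)
    (ψ : Matrix ι ι ℤ_[p] → G) (h : ∀ g x, φ (g + x) = ψ g + φ x)
    (hfin : ν (Set.range φ) ≠ ⊤) (E : Set (Matrix ι ι ℤ_[p])) :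
    ν (φ '' E) = ν (Set.range φ) * haarInt p ι E := by
  have huniv : (ν.comap φ) Set.univ = ν (Set.range φ) := by
    rw [hφ.comap_apply, Set.image_univ]
  have : IsFiniteMeasure (ν.comap φ) := ⟨by rw [huniv]; exact hfin.lt_top⟩
  have : (ν.comap φ).IsAddLeftInvariant := by
    refine ⟨fun g => Measure.ext fun s hs => ?_⟩
    rw [Measure.map_apply (measurable_const_add g) hs, hφ.comap_apply, hφ.comap_apply]
    have : φ '' ((fun x => g + x) ⁻¹' s) = (fun z => ψ g + z) ⁻¹' (φ '' s) := by
      ext z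
      constructor
      · rintro ⟨x, hx, rfl⟩
        exact ⟨g + x, hx, h g x⟩
      · rintro ⟨w, hw, hz⟩
        refine ⟨-g + w, by simpa using hw, ?_⟩
        have h1 := h g (-g + w)
        rw [add_neg_cancel_left, hz] at h1
        exact (add_left_cancel h1).symm
    rw [this, measure_preimage_add]
  have h1 := eq_smul_haarInt (ν.comap φ)
  rw [← hφ.comap_apply, ← huniv]
  conv_lhs => rw [h1]
  rfl

/-- The image of Haar measure under a continuous surjective homomorphism is an invariant probability
measure, hence is Haar measure by uniqueness. -/
theorem haarInt_preimage_addHom (T : Matrix ι ι ℤ_[p] →+ Matrix κ κ ℤ_[p]) (hT : Continuous T)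
    (hsurj : Function.Surjective T) {E : Set (Matrix κ κ ℤ_[p])} (hE : MeasurableSet E) :
    haarInt p ι (T ⁻¹' E) = haarInt p κ E := by
  have : IsProbabilityMeasure ((haarInt p ι).map T) :=
    Measure.isProbabilityMeasure_map hT.measurable.aemeasurable
  have : ((haarInt p ι).map T).IsAddLeftInvariant :=
    isAddLeftInvariant_map (T : Matrix ι ι ℤ_[p] →ₙ+ Matrix κ κ ℤ_[p]) hT.measurable hsurj
  rw [← Measure.map_apply hT.measurable hE, eq_haarInt ((haarInt p ι).map T)]

/-! ### Congruences -/

theorem isOpen_setOf_dvd_sub (n : ℕ) (A : Matrix ι ι ℤ_[p]) :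
    IsOpen {B : Matrix ι ι ℤ_[p] | ∀ i j, (p : ℤ_[p]) ^ n ∣ B i j - A i j} := by
  have : {B : Matrix ι ι ℤ_[p] | ∀ i j, (p : ℤ_[p]) ^ n ∣ B i j - A i j} =
      ⋂ i, ⋂ j, (fun B : Matrix ι ι ℤ_[p] => B i j) ⁻¹'
        Metric.closedBall (A i j) ((p : ℝ) ^ (-n : ℤ)) := by
    ext B
    simp only [Set.mem_ofPred_eq, Set.mem_iInter, Set.mem_preimage, Metric.mem_closedBall,
      dist_eq_norm, PadicInt.norm_le_pow_iff_mem_span_pow, Ideal.mem_span_singleton]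
  rw [this]
  have hp0 := hp.out.pos
  exact isOpen_iInter_of_finite fun i => isOpen_iInter_of_finite fun j =>
    (IsUltrametricDist.isOpen_closedBall _ (by positivity)).preimage
      (continuous_apply_apply i j)

/-- A perturbation by `p ^ n C` changes `A x` by a multiple of `p ^ n`. Hence `depth n` is locally
constant, which is what makes it measurable. -/
theorem depth_congr {n : ℕ} {A B : Matrix ι ι ℤ_[p]} (h : ∀ i j, (p : ℤ_[p]) ^ n ∣ B i j - A i j) :
    depth n B = depth n A := by
  have key {A B : Matrix ι ι ℤ_[p]} (h : ∀ i j, (p : ℤ_[p]) ^ n ∣ B i j - A i j) :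
      depthSpace n A ≤ depthSpace n B := by
    choose C hC using h
    have hB : B = A + (p : ℤ_[p]) ^ n • Matrix.of C := by
      ext i j
      simp [← hC]
    rintro _ ⟨x, y, hx, rfl⟩
    exact ⟨x, y + (Matrix.of C).mulVec x, by
      rw [hB, Matrix.add_mulVec, hx, Matrix.smul_mulVec, smul_add], rfl⟩
  rw [depth, depth, le_antisymm (key h) (key fun i j => by rw [← neg_sub, dvd_neg]; exact h i j)]

theorem measurableSet_depth (n : ℕ) (c : ℕ) :
    MeasurableSet {A : Matrix ι ι ℤ_[p] | depth n A = c} := by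
  refine (isOpen_iff_mem_nhds.2 fun A hA => ?_).measurableSet
  refine Filter.mem_of_superset ((isOpen_setOf_dvd_sub n A).mem_nhds (by simp)) fun B hB => ?_
  rw [Set.mem_ofPred_eq, depth_congr hB]
  exact hA

theorem measurableSet_depth_le (n : ℕ) (y : ℕ → ℕ) :
    MeasurableSet {A : Matrix ι ι ℤ_[p] | ∀ i ≤ n, depth i A = y i} := by
  have : {A : Matrix ι ι ℤ_[p] | ∀ i ≤ n, depth i A = y i} =
      ⋂ i, ⋂ (_ : i ≤ n), {A | depth i A = y i} := by ext; simp
  rw [this]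
  exact MeasurableSet.iInter fun i => MeasurableSet.iInter fun _ => measurableSet_depth i (y i)

/-- The matrices with given reduction modulo `p`. -/
def residueClass (Z : Matrix ι ι (ZMod p)) : Set (Matrix ι ι ℤ_[p]) :=
  {A | A.map PadicInt.toZMod = Z}

theorem residueClass_map (A : Matrix ι ι ℤ_[p]) : residueClass (A.map PadicInt.toZMod) =
    Set.range fun V : Matrix ι ι ℤ_[p] => A + (p : ℤ_[p]) • V := by
  ext B
  constructor
  · intro h
    have h1 (i j) : (p : ℤ_[p]) ∣ B i j - A i j := by
      rw [← toZMod_eq_zero_iff, map_sub, sub_eq_zero]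
      exact congrFun (congrFun h i) j
    choose C hC using h1
    exact ⟨Matrix.of C, by ext i j; simp [← hC]⟩
  · rintro ⟨V, rfl⟩
    ext i j
    simp

theorem exists_map_toZMod (Z : Matrix ι ι (ZMod p)) :
    ∃ A : Matrix ι ι ℤ_[p], A.map PadicInt.toZMod = Z :=
  ⟨Matrix.of fun i j => (ZMod.ringHom_surjective PadicInt.toZMod (Z i j)).choose,
    Matrix.ext fun i j => (ZMod.ringHom_surjective PadicInt.toZMod (Z i j)).choose_spec⟩

theorem measurableSet_residueClass (Z : Matrix ι ι (ZMod p)) : MeasurableSet (residueClass Z) := by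
  obtain ⟨A, rfl⟩ := exists_map_toZMod Z
  convert (isOpen_setOf_dvd_sub 1 A).measurableSet using 1
  ext B
  simp only [pow_one, ← toZMod_eq_zero_iff, map_sub, sub_eq_zero, Set.mem_ofPred_eq, residueClass]
  exact ⟨fun h i j => congrFun (congrFun h i) j, fun h => Matrix.ext h⟩

theorem sum_haarInt_residueClass (E : Set (Matrix ι ι ℤ_[p])) (hE : MeasurableSet E) :
    haarInt p ι E = ∑ Z : Matrix ι ι (ZMod p), haarInt p ι (E ∩ residueClass Z) := by
  rw [← measure_biUnion_finset]
  · congr 1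
    ext A
    simp [residueClass]
  · intro Z _ Z' _ h
    refine Set.disjoint_left.2 fun A hA hA' => h ?_
    exact hA.2.symm.trans hA'.2
  · exact fun Z _ => hE.inter (measurableSet_residueClass Z)

/-- The `p^{n²}` residue classes are translates of one another and partition the space. The
multiplicative form avoids division in `ENNReal`. -/
theorem haarInt_residueClass (Z : Matrix ι ι (ZMod p)) :
    (p : ENNReal) ^ (Fintype.card ι ^ 2) * haarInt p ι (residueClass Z) = 1 := by
  have h (Z' : Matrix ι ι (ZMod p)) :
      haarInt p ι (residueClass Z') = haarInt p ι (residueClass Z) := by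
    obtain ⟨A, rfl⟩ := exists_map_toZMod Z
    obtain ⟨A', rfl⟩ := exists_map_toZMod Z'
    rw [← measure_preimage_add _ (A - A') (residueClass (A.map _))]
    congr 1
    ext B
    simp only [residueClass, Set.mem_ofPred_eq, Set.mem_preimage]
    constructor
    · intro h
      ext i j
      have := congrFun (congrFun h i) j
      simp only [Matrix.map_apply] at this
      simp [this]
    · intro h
      ext i j
      have := congrFun (congrFun h i) j
      simp only [Matrix.map_apply, Matrix.add_apply, Matrix.sub_apply, map_add, map_sub] at this
      simp only [Matrix.map_apply]
      linear_combination this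
  have := sum_haarInt_residueClass (p := p) (ι := ι) Set.univ MeasurableSet.univ
  simp only [Set.univ_inter, h, measure_univ, Finset.sum_const, Finset.card_univ, nsmul_eq_mul]
    at this
  have hcard : Fintype.card (Matrix ι ι (ZMod p)) = p ^ (Fintype.card ι ^ 2) := by
    rw [Fintype.card_congr (Matrix.of (m := ι) (n := ι) (α := ZMod p)).symm]
    simp [ZMod.card, ← pow_mul, pow_two]
  rw [this, hcard, Nat.cast_pow]

theorem measurableEmbedding_add_smul (A : Matrix ι ι ℤ_[p]) :
    MeasurableEmbedding fun V : Matrix ι ι ℤ_[p] => A + (p : ℤ_[p]) • V := by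
  refine (Continuous.isClosedEmbedding (by fun_prop) ?_).measurableEmbedding
  intro V V' h
  exact smul_right_injective _ (PadicInt.prime_p.ne_zero) (add_left_cancel h)

theorem haarInt_image_add_smul (A : Matrix ι ι ℤ_[p]) (E : Set (Matrix ι ι ℤ_[p])) :
    (p : ENNReal) ^ (Fintype.card ι ^ 2) *
      haarInt p ι ((fun V : Matrix ι ι ℤ_[p] => A + (p : ℤ_[p]) • V) '' E) = haarInt p ι E := by
  rw [measure_image_eq _ (measurableEmbedding_add_smul A) (fun V => (p : ℤ_[p]) • V)
    (fun g x => by rw [smul_add]; abel) (measure_ne_top _ _), ← residueClass_map, ← mul_assoc,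
    haarInt_residueClass, one_mul]

/-- The conditional law given the reduction modulo `p`: a uniform matrix in the class of `A` is `A +
p V` with `V` uniform. -/
theorem haarInt_inter_residueClass (A : Matrix ι ι ℤ_[p]) (E : Set (Matrix ι ι ℤ_[p])) :
    (p : ENNReal) ^ (Fintype.card ι ^ 2) *
      haarInt p ι (E ∩ residueClass (A.map PadicInt.toZMod)) =
        haarInt p ι {V | A + (p : ℤ_[p]) • V ∈ E} := by
  rw [← haarInt_image_add_smul A {V | A + (p : ℤ_[p]) • V ∈ E}, residueClass_map,
    ← Set.image_preimage_eq_inter_range]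
  rfl

/-! ### The Schur complement of a uniform matrix -/

theorem continuousOn_ringInverse : ContinuousOn (Ring.inverse : ℤ_[p] → ℤ_[p]) {x | IsUnit x} :=
  fun x hx => by
    obtain ⟨u, rfl⟩ := hx
    exact (NormedRing.inverse_continuousAt u).continuousWithinAt

theorem continuous_matrix_inv {X : Type*} [TopologicalSpace X] {f : X → Matrix ι ι ℤ_[p]}
    (hf : Continuous f) (hu : ∀ x, IsUnit (f x)) : Continuous fun x => (f x)⁻¹ := by
  simp only [Matrix.inv_def]
  have h : Continuous fun x => Ring.inverse (f x).det :=
    continuousOn_ringInverse.comp_continuous hf.matrix_det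
      fun x => (Matrix.isUnit_iff_isUnit_det _).1 (hu x)
  exact h.smul hf.matrix_adjugate

theorem isUnit_diagonal_add {d : ι → ℤ_[p]} (hd : ∀ i, IsUnit (d i)) (V : Matrix ι ι ℤ_[p]) :
    IsUnit (Matrix.diagonal d + (p : ℤ_[p]) • V) := by
  rw [Matrix.isUnit_iff_isUnit_det, isUnit_iff_toZMod_ne_zero, RingHom.map_det]
  have : PadicInt.toZMod.mapMatrix (Matrix.diagonal d + (p : ℤ_[p]) • V) =
      Matrix.diagonal fun i => PadicInt.toZMod (d i) := by
    ext i j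
    by_cases h : i = j <;> simp [h]
  rw [this, Matrix.det_diagonal]
  exact Finset.prod_ne_zero_iff.2 fun i _ => (isUnit_iff_toZMod_ne_zero _).1 (hd i)

/-- The Schur complement of the upper left block of `diag(d, p d') + p V`, divided by `p`. -/
noncomputable def schur (d : ι → ℤ_[p]) (d' : κ → ℤ_[p]) (V : Matrix (ι ⊕ κ) (ι ⊕ κ) ℤ_[p]) :
    Matrix κ κ ℤ_[p] :=
  Matrix.diagonal d' + V.toBlocks₂₂ - (p : ℤ_[p]) •
    (V.toBlocks₂₁ * (Matrix.diagonal d + (p : ℤ_[p]) • V.toBlocks₁₁)⁻¹ * V.toBlocks₁₂)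

theorem continuous_schur {d : ι → ℤ_[p]} (hd : ∀ i, IsUnit (d i)) (d' : κ → ℤ_[p]) :
    Continuous (schur d d') := by
  have h11 : Continuous fun V : Matrix (ι ⊕ κ) (ι ⊕ κ) ℤ_[p] => V.toBlocks₁₁ :=
    continuous_id.matrix_submatrix Sum.inl Sum.inl
  have h12 : Continuous fun V : Matrix (ι ⊕ κ) (ι ⊕ κ) ℤ_[p] => V.toBlocks₁₂ :=
    continuous_id.matrix_submatrix Sum.inl Sum.inr
  have h21 : Continuous fun V : Matrix (ι ⊕ κ) (ι ⊕ κ) ℤ_[p] => V.toBlocks₂₁ :=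
    continuous_id.matrix_submatrix Sum.inr Sum.inl
  have h22 : Continuous fun V : Matrix (ι ⊕ κ) (ι ⊕ κ) ℤ_[p] => V.toBlocks₂₂ :=
    continuous_id.matrix_submatrix Sum.inr Sum.inr
  have hinv := continuous_matrix_inv (continuous_const.add (h11.const_smul (p : ℤ_[p])))
    fun V => isUnit_diagonal_add hd V.toBlocks₁₁
  exact (continuous_const.add h22).sub
    (((h21.matrix_mul hinv).matrix_mul h12).const_smul (p : ℤ_[p]))

/-- Translating the lower right block of `V` by `g` translates the Schur complement by `g` and
leaves the correction term alone. The image of Haar measure is therefore an invariant probability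
measure; no independence of the blocks is used. -/
theorem haarInt_preimage_schur {d : ι → ℤ_[p]} (hd : ∀ i, IsUnit (d i)) (d' : κ → ℤ_[p])
    {E : Set (Matrix κ κ ℤ_[p])} (hE : MeasurableSet E) :
    haarInt p (ι ⊕ κ) (schur d d' ⁻¹' E) = haarInt p κ E := by
  have hm := (continuous_schur hd d').measurable
  have : IsProbabilityMeasure ((haarInt p (ι ⊕ κ)).map (schur d d')) :=
    Measure.isProbabilityMeasure_map hm.aemeasurable
  have : ((haarInt p (ι ⊕ κ)).map (schur d d')).IsAddLeftInvariant := by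
    refine ⟨fun g => ?_⟩
    rw [Measure.map_map (measurable_const_add g) hm]
    have : (fun x => g + x) ∘ schur d d' =
        schur d d' ∘ fun V => Matrix.fromBlocks 0 0 0 g + V := by
      ext1 V
      simp only [Function.comp_apply, schur]
      have h11 : (Matrix.fromBlocks 0 0 0 g + V).toBlocks₁₁ = V.toBlocks₁₁ := by
        ext; simp [Matrix.toBlocks₁₁]
      have h12 : (Matrix.fromBlocks 0 0 0 g + V).toBlocks₁₂ = V.toBlocks₁₂ := by
        ext; simp [Matrix.toBlocks₁₂]
      have h21 : (Matrix.fromBlocks 0 0 0 g + V).toBlocks₂₁ = V.toBlocks₂₁ := by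
        ext; simp [Matrix.toBlocks₂₁]
      have h22 : (Matrix.fromBlocks 0 0 0 g + V).toBlocks₂₂ = g + V.toBlocks₂₂ := by
        ext; simp [Matrix.toBlocks₂₂]
      rw [h11, h12, h21, h22]
      abel
    rw [this, ← Measure.map_map hm (measurable_const_add _), map_add_left_eq_self]
  rw [← Measure.map_apply hm hE, eq_haarInt ((haarInt p (ι ⊕ κ)).map (schur d d'))]

theorem depth_succ_diagonal_add (n : ℕ) {d : ι → ℤ_[p]} (hd : ∀ i, IsUnit (d i))
    (d' : κ → ℤ_[p]) (V : Matrix (ι ⊕ κ) (ι ⊕ κ) ℤ_[p]) :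
    depth (n + 1) (Matrix.diagonal (Sum.elim d ((p : ℤ_[p]) • d')) + (p : ℤ_[p]) • V) =
      depth n (schur d d' V) := by
  rw [schur, ← depth_succ_fromBlocks n (isUnit_diagonal_add hd V.toBlocks₁₁)]
  congr 1
  ext (i | i) (j | j)
  · simp [Matrix.diagonal_apply, Matrix.toBlocks₁₁]
  · simp [Matrix.toBlocks₁₂]
  · simp [Matrix.toBlocks₂₁]
  · simp [Matrix.diagonal_apply, Matrix.toBlocks₂₂]

/-! ### The law of the depths of a uniform matrix -/

/-- Invertible factors do not change the rank modulo `p`, and the reduced diagonal matrix has rank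
the number of unit entries. -/
theorem card_isUnit_eq_rank {A b c : Matrix ι ι ℤ_[p]} (hb : IsUnit b) (hc : IsUnit c)
    {d : ι → ℤ_[p]} (h : A = b * Matrix.diagonal d * c) :
    Nat.card {i // ¬ IsUnit (d i)} = Fintype.card ι - (A.map PadicInt.toZMod).rank := by
  classical
  have hA : A.map PadicInt.toZMod = b.map PadicInt.toZMod *
      Matrix.diagonal (fun i => PadicInt.toZMod (d i)) * c.map PadicInt.toZMod := by
    rw [h, Matrix.map_mul, Matrix.map_mul, Matrix.diagonal_map (map_zero _)]
  have hb' : IsUnit (b.map (PadicInt.toZMod (p := p))) := hb.map PadicInt.toZMod.mapMatrix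
  have hc' : IsUnit (c.map (PadicInt.toZMod (p := p))) := hc.map PadicInt.toZMod.mapMatrix
  rw [hA, Matrix.rank_mul_eq_left_of_isUnit_det _ _ ((Matrix.isUnit_iff_isUnit_det _).1 hc'),
    Matrix.rank_mul_eq_right_of_isUnit_det _ _ ((Matrix.isUnit_iff_isUnit_det _).1 hb'),
    Matrix.rank_diagonal, Nat.card_eq_fintype_card]
  have := Fintype.card_subtype_compl fun i => IsUnit (d i)
  rw [this]
  simp only [isUnit_iff_toZMod_ne_zero]

/-- The Markov property of the depths. Conditioning on the reduction modulo `p` and passing to the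
Schur complement leaves a uniform matrix whose size is the corank, with all depths shifted by one.
The index type is quantified inside the induction because that size changes. -/
theorem haarInt_depth (n : ℕ) : ∀ (ι : Type) [Fintype ι] [DecidableEq ι] (y : ℕ → ℕ),
    y 0 = Fintype.card ι →
    haarInt p ι {A | ∀ i ≤ n, depth i A = y i} =
      ENNReal.ofReal (∏ i ∈ Finset.range n, transition p 0 (y i) (y (i + 1))) := by
  have hs : (-1 : ℝ) < 0 := by norm_num
  induction n with
  | zero =>
    intro ι _ _ y hy
    have : {A : Matrix ι ι ℤ_[p] | ∀ i ≤ 0, depth i A = y i} = Set.univ := by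
      ext A
      simp [depth_zero, hy]
    rw [this]
    simp
  | succ n ih =>
    intro ι _ _ y hy
    classical
    set R : ENNReal :=
      ENNReal.ofReal (∏ i ∈ Finset.range n, transition p 0 (y (i + 1)) (y (i + 1 + 1))) with hR
    -- The conditional probability depends on the residue class only through its corank.
    have key (Z : Matrix ι ι (ZMod p)) : (p : ENNReal) ^ (Fintype.card ι ^ 2) *
        haarInt p ι ({A | ∀ i ≤ n + 1, depth i A = y i} ∩ residueClass Z) =
          if Fintype.card ι - Z.rank = y 1 then R else 0 := by
      obtain ⟨A, rfl⟩ := exists_map_toZMod Z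
      obtain ⟨b, c, hb, hc, d, hA⟩ := isDiagonalizable A
      rw [haarInt_inter_residueClass, ← card_isUnit_eq_rank hb hc hA]
      have hd2 (i : {i // ¬ IsUnit (d i)}) : ∃ z, d i = p * z := by
        have := i.2
        rw [isUnit_iff_toZMod_ne_zero, not_not, toZMod_eq_zero_iff] at this
        exact this
      choose d' hd' using hd2
      let e : {i // IsUnit (d i)} ⊕ {i // ¬ IsUnit (d i)} ≃ ι := Equiv.sumCompl _
      have hde : d ∘ e = Sum.elim (fun i : {i // IsUnit (d i)} => d i) ((p : ℤ_[p]) • d') := by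
        ext (i | i)
        · simp [e]
        · simp [e, hd']
      obtain ⟨ub, rfl⟩ := hb
      obtain ⟨uc, rfl⟩ := hc
      -- Multiplying out the invertible factors of `A = b d c` turns the perturbation `V` into `b⁻¹
      -- V c⁻¹`, listed with the unit entries of `d` first. This is an additive surjection, so the
      -- perturbation stays uniform.
      let T : Matrix ι ι ℤ_[p] →+
          Matrix ({i // IsUnit (d i)} ⊕ {i // ¬ IsUnit (d i)}) _ ℤ_[p] :=
        { toFun := fun V => ((↑ub⁻¹ : Matrix ι ι ℤ_[p]) * V *
            (↑uc⁻¹ : Matrix ι ι ℤ_[p])).submatrix e e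
          map_zero' := by simp
          map_add' := fun V W => by rw [mul_add, add_mul]; rfl }
      have hTc : Continuous T := by
        have : Continuous fun V : Matrix ι ι ℤ_[p] => (↑ub⁻¹ : Matrix ι ι ℤ_[p]) * V *
            (↑uc⁻¹ : Matrix ι ι ℤ_[p]) := by fun_prop
        exact this.matrix_submatrix e e
      have hTs : Function.Surjective T := fun W => by
        refine ⟨(ub : Matrix ι ι ℤ_[p]) * W.submatrix e.symm e.symm * (uc : Matrix ι ι ℤ_[p]), ?_⟩
        simp [T, mul_assoc]
      have hdepth (i : ℕ) (V : Matrix ι ι ℤ_[p]) : depth (i + 1) (A + (p : ℤ_[p]) • V) =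
          depth i (schur (fun i : {i // IsUnit (d i)} => d i) d' (T V)) := by
        have h1 : A + (p : ℤ_[p]) • V = (ub : Matrix ι ι ℤ_[p]) * (Matrix.diagonal d + (p : ℤ_[p]) •
            ((↑ub⁻¹ : Matrix ι ι ℤ_[p]) * V * (↑uc⁻¹ : Matrix ι ι ℤ_[p]))) * (uc : Matrix ι ι ℤ_[p]) := by
          rw [hA]
          simp [mul_add, add_mul, mul_assoc]
        rw [h1, depth_mul_mul _ _ ub.isUnit uc.isUnit, ← depth_submatrix _ _ e,
          ← depth_succ_diagonal_add i (fun i => i.2) d', ← hde, Matrix.submatrix_add,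
          Pi.add_apply, Pi.add_apply, Matrix.submatrix_diagonal_equiv]
        rfl
      have hset : {V | A + (p : ℤ_[p]) • V ∈ {A | ∀ i ≤ n + 1, depth i A = y i}} =
          T ⁻¹' (schur (fun i : {i // IsUnit (d i)} => d i) d' ⁻¹'
            {W | ∀ i ≤ n, depth i W = y (i + 1)}) := by
        ext V
        simp only [Set.mem_ofPred_eq, Set.mem_preimage]
        constructor
        · intro h i hi
          rw [← hdepth]
          exact h (i + 1) (by omega)
        · intro h i hi
          rcases i with _ | i
          · rw [depth_zero, hy]
          · rw [hdepth]
            exact h i (by omega)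
      have hms := measurableSet_depth_le (p := p) (ι := {i // ¬ IsUnit (d i)}) n
        fun i => y (i + 1)
      rw [hset, haarInt_preimage_addHom T hTc hTs
        ((continuous_schur (fun i => i.2) d').measurable hms),
        haarInt_preimage_schur (fun i => i.2) d' hms]
      split_ifs with h1
      · rw [ih _ (fun i => y (i + 1)) (by rw [← Nat.card_eq_fintype_card]; exact h1.symm)]
      -- The depth at index `0` is the size of the matrix, so a corank other than `y 1` makes the
      -- event empty.
      · have : {W : Matrix {i // ¬ IsUnit (d i)} {i // ¬ IsUnit (d i)} ℤ_[p] |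
            ∀ i ≤ n, depth i W = y (i + 1)} = ∅ := by
          ext W
          simp only [Set.mem_ofPred_eq, Set.mem_empty_iff_false, iff_false]
          intro h
          apply h1
          have := h 0 (by omega)
          rwa [depth_zero, ← Nat.card_eq_fintype_card] at this
        rw [this, measure_empty]
    have hp0 : (p : ENNReal) ^ (Fintype.card ι ^ 2) ≠ 0 :=
      pow_ne_zero _ (by exact_mod_cast hp.out.ne_zero)
    have hpt : (p : ENNReal) ^ (Fintype.card ι ^ 2) ≠ ⊤ := ENNReal.pow_ne_top (by simp)
    rw [← ENNReal.mul_right_inj hp0 hpt, sum_haarInt_residueClass _ (measurableSet_depth_le _ _),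
      Finset.mul_sum, Finset.sum_congr rfl fun Z _ => key Z, Finset.sum_ite, Finset.sum_const_zero,
      add_zero, Finset.sum_const, nsmul_eq_mul, Finset.prod_range_succ', hy, mul_comm (∏ _ ∈ _, _),
      ENNReal.ofReal_mul (transition_nonneg hs _ _), ← mul_assoc]
    congr 1
    have h1 := card_filter_corank p ι (y 1)
    rw [← ENNReal.ofReal_natCast, h1, ENNReal.ofReal_mul (by positivity),
      ENNReal.ofReal_pow (by positivity), ENNReal.ofReal_natCast]

end

/-! ### Counting functions of a tuple -/

section
variable {N : ℕ}

theorem cumul_eq_card (k : SingularTuple N) (i : ℤ) :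
    cumul k i = (Finset.univ.filter fun j => k.1 j ≤ (i : WithBot ℤ)).card := by
  classical
  have h1 := finsum_mem_eq_sum_of_inter_support_eq (mult k) (s := {j | j ≤ (i : WithBot ℤ)})
    (t := (Finset.univ.image k.1).filter fun j => j ≤ (i : WithBot ℤ)) (by
      ext j
      simp only [Set.mem_inter_iff, Function.mem_support, Finset.coe_filter, Set.mem_ofPred_eq,
        Finset.mem_image, Finset.mem_univ, true_and]
      constructor
      · rintro ⟨h, h'⟩
        refine ⟨⟨?_, h⟩, h'⟩
        obtain ⟨t, ht⟩ := Finset.card_ne_zero.1 h'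
        exact ⟨t, (Finset.mem_filter.1 ht).2⟩
      · rintro ⟨⟨_, h⟩, h'⟩
        exact ⟨h, h'⟩)
  refine h1.trans ?_
  rw [Finset.card_eq_sum_card_fiberwise (f := k.1)
    (t := (Finset.univ.image k.1).filter fun j => j ≤ (i : WithBot ℤ)) (fun t ht => by
      simpa using ht)]
  refine Finset.sum_congr rfl fun j hj => ?_
  rw [mult, Finset.filter_filter]
  congr 1
  ext t
  simp only [Finset.mem_filter, Finset.mem_univ, true_and] at hj ⊢
  exact ⟨fun h => ⟨h ▸ hj.2, h⟩, fun h => h.2⟩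

theorem cumul_le (k : SingularTuple N) (i : ℤ) : cumul k i ≤ N := by
  rw [cumul_eq_card]
  simpa using Finset.card_filter_le (Finset.univ : Finset (Fin N)) _

theorem cumul_mono (k : SingularTuple N) : Monotone (cumul k) := fun i j h => by
  rw [cumul_eq_card, cumul_eq_card]
  refine Finset.card_le_card fun t ht => ?_
  simp only [Finset.mem_filter, Finset.mem_univ, true_and] at ht ⊢
  exact ht.trans (by exact_mod_cast h)

theorem cumul_eq_iff (k : SingularTuple N) (i : ℤ) :
    cumul k i = N ↔ ∀ j, k.1 j ≤ (i : WithBot ℤ) := by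
  rw [cumul_eq_card]
  have := Finset.card_filter_eq_iff (s := (Finset.univ : Finset (Fin N)))
    (p := fun j => k.1 j ≤ (i : WithBot ℤ))
  simpa using this

/-- The entries of a decreasing tuple that are at most `i` occupy its last `cumul k i` places. The
counting functions therefore determine the tuple. -/
theorem le_iff_of_cumul (k : SingularTuple N) (i : ℤ) (j : Fin N) :
    k.1 j ≤ (i : WithBot ℤ) ↔ N ≤ j + cumul k i := by
  rw [cumul_eq_card]
  constructor
  · intro h
    have h1 : Finset.Ici j ⊆ Finset.univ.filter fun t => k.1 t ≤ (i : WithBot ℤ) := fun t ht => by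
      simp only [Finset.mem_filter, Finset.mem_univ, true_and]
      exact (k.2 (Finset.mem_Ici.1 ht)).trans h
    have := Finset.card_le_card h1
    rw [Fin.card_Ici] at this
    omega
  · intro h
    by_contra hj
    have h1 : (Finset.univ.filter fun t => k.1 t ≤ (i : WithBot ℤ)) ⊆ Finset.Ioi j := fun t ht => by
      simp only [Finset.mem_filter, Finset.mem_univ, true_and] at ht
      rw [Finset.mem_Ioi]
      by_contra htj
      exact hj ((k.2 (not_lt.1 htj)).trans ht)
    have := Finset.card_le_card h1
    rw [Fin.card_Ioi] at this
    omega

theorem eq_of_cumul_eq {k k' : SingularTuple N} (h : ∀ i, cumul k i = cumul k' i) : k = k' := by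
  have key (j : Fin N) (i : ℤ) : k.1 j ≤ (i : WithBot ℤ) ↔ k'.1 j ≤ (i : WithBot ℤ) := by
    rw [le_iff_of_cumul, le_iff_of_cumul, h]
  refine Subtype.ext (funext fun j => ?_)
  have aux {x y : WithBot ℤ} (h : ∀ i : ℤ, y ≤ (i : WithBot ℤ) → x ≤ (i : WithBot ℤ)) : x ≤ y := by
    induction y with
    | bot =>
      induction x with
      | bot => exact le_rfl
      | coe x =>
        -- The value `-∞` is recognized as the only one lying below every integer.
        have := h (x - 1) bot_le
        rw [WithBot.coe_le_coe] at this
        omega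
    | coe y => exact h y le_rfl
  exact le_antisymm (aux fun i => (key j i).2) (aux fun i => (key j i).1)

theorem upper_antitone (k : SingularTuple N) : Antitone (upper k) := fun i j h =>
  Nat.sub_le_sub_left (cumul_mono k (by exact_mod_cast h)) N

theorem cumul_natCast (k : SingularTuple N) (i : ℕ) : cumul k (i : ℤ) = N - upper k i := by
  rw [upper, Nat.sub_sub_self (cumul_le k i)]

theorem lower_le (k : SingularTuple N) (i : ℕ) : lower k i ≤ N := cumul_le k _

theorem upper_zero (k : SingularTuple N) : upper k 0 = N - lower k 0 := by
  simp [upper, lower]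

theorem eq_of_upper_lower {k k' : SingularTuple N} (hu : ∀ i, upper k i = upper k' i)
    (hl : ∀ i, lower k i = lower k' i) : k = k' := by
  refine eq_of_cumul_eq fun i => ?_
  rcases Int.eq_nat_or_neg i with ⟨n, rfl | rfl⟩
  · rw [cumul_natCast, cumul_natCast, hu]
  · exact hl n

theorem exists_forall_le (k : SingularTuple N) : ∃ m : ℕ, ∀ j, k.1 j ≤ ((m : ℤ) : WithBot ℤ) := by
  have h (j : Fin N) : ∃ m : ℕ, k.1 j ≤ ((m : ℤ) : WithBot ℤ) := by
    rcases hk : k.1 j with _ | z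
    · exact ⟨0, bot_le⟩
    · exact ⟨z.toNat, WithBot.coe_le_coe.2 (Int.self_le_toNat z)⟩
  choose m hm using h
  refine ⟨∑ j, m j, fun j => (hm j).trans (WithBot.coe_le_coe.2 ?_)⟩
  exact_mod_cast Finset.single_le_sum (f := m) (fun _ _ => Nat.zero_le _) (Finset.mem_univ j)

theorem upper_eq_zero_iff (k : SingularTuple N) (m : ℕ) :
    upper k m = 0 ↔ ∀ j, k.1 j ≤ ((m : ℤ) : WithBot ℤ) := by
  have := cumul_le k m
  rw [← cumul_eq_iff, upper]
  omega

theorem upper_eq_card (k : SingularTuple N) (i : ℕ) :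
    upper k i = (Finset.univ.filter fun j => ((i : ℤ) : WithBot ℤ) < k.1 j).card := by
  have h := Finset.card_filter_add_card_filter_not (s := (Finset.univ : Finset (Fin N)))
    (fun j => k.1 j ≤ ((i : ℤ) : WithBot ℤ))
  simp only [not_le, Finset.card_univ, Fintype.card_fin] at h
  rw [upper, cumul_eq_card]
  omega

instance : Countable (SingularTuple N) := by
  unfold SingularTuple
  have : Countable (WithBot ℤ) := inferInstanceAs (Countable (Option ℤ))
  infer_instance

end

/-! ### Singular numbers of `p`-adic matrices -/

section
variable {p : ℕ} [hp : Fact p.Prime] {N : ℕ}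

/-- The embedding `A ↦ p^{-m} A` of `Mat(N, ℤ_p)` into `Mat(N, ℚ_p)`. -/
noncomputable def scaled (m : ℕ) (A : Matrix (Fin N) (Fin N) ℤ_[p]) :
    Matrix (Fin N) (Fin N) ℚ_[p] :=
  ((p : ℚ_[p]) ^ m)⁻¹ • A.map fun x => (x : ℚ_[p])

theorem map_coe_mul (A B : Matrix (Fin N) (Fin N) ℤ_[p]) :
    (A * B).map (fun x => (x : ℚ_[p])) =
      A.map (fun x => (x : ℚ_[p])) * B.map (fun x => (x : ℚ_[p])) :=
  Matrix.map_mul (f := PadicInt.Coe.ringHom (p := p))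

theorem map_coe_one : (1 : Matrix (Fin N) (Fin N) ℤ_[p]).map (fun x => (x : ℚ_[p])) = 1 :=
  Matrix.map_one _ (map_zero PadicInt.Coe.ringHom) (map_one PadicInt.Coe.ringHom)

theorem cast_prime_ne_zero : (p : ℚ_[p]) ≠ 0 := by exact_mod_cast hp.out.ne_zero

theorem scaled_injective (m : ℕ) : Function.Injective (scaled (p := p) (N := N) m) := by
  intro A B h
  have hp0 : ((p : ℚ_[p]) ^ m)⁻¹ ≠ 0 := inv_ne_zero (pow_ne_zero _ cast_prime_ne_zero)
  have h1 := smul_right_injective _ hp0 h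
  ext1 i j
  exact PadicInt.ext (congrFun (congrFun h1 i) j)

theorem exists_scaled_eq_iff (m : ℕ) (Z : Matrix (Fin N) (Fin N) ℚ_[p]) :
    Z ∈ Set.range (scaled m) ↔ ∀ i j, ‖Z i j‖ ≤ (p : ℝ) ^ m := by
  have hp0 : (0 : ℝ) < p := by exact_mod_cast hp.out.pos
  have hm : ‖((p : ℚ_[p]) ^ m)‖ = ((p : ℝ) ^ m)⁻¹ := by simp
  constructor
  · rintro ⟨A, rfl⟩ i j
    simp only [scaled, Matrix.smul_apply, Matrix.map_apply, smul_eq_mul, norm_mul, norm_inv, hm,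
      inv_inv]
    exact mul_le_of_le_one_right (by positivity) (A i j).2
  · intro h
    have h1 (i j) : ‖(p : ℚ_[p]) ^ m * Z i j‖ ≤ 1 := by
      rw [norm_mul, hm]
      calc ((p : ℝ) ^ m)⁻¹ * ‖Z i j‖ ≤ ((p : ℝ) ^ m)⁻¹ * (p : ℝ) ^ m := by gcongr; exact h i j
        _ = 1 := inv_mul_cancel₀ (by positivity)
    refine ⟨Matrix.of fun i j => ⟨_, h1 i j⟩, ?_⟩
    ext i j
    exact inv_mul_cancel_left₀ (pow_ne_zero m cast_prime_ne_zero) (Z i j)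

theorem exists_scaled (Z : Matrix (Fin N) (Fin N) ℚ_[p]) : ∃ m, Z ∈ Set.range (scaled m) := by
  have h1 : (1 : ℝ) < p := by exact_mod_cast hp.out.one_lt
  obtain ⟨m, hm⟩ := pow_unbounded_of_one_lt (∑ i, ∑ j, ‖Z i j‖) h1
  refine ⟨m, (exists_scaled_eq_iff m Z).2 fun i j => le_trans ?_ hm.le⟩
  calc ‖Z i j‖ ≤ ∑ j, ‖Z i j‖ :=
        Finset.single_le_sum (f := fun j => ‖Z i j‖) (fun _ _ => norm_nonneg _) (Finset.mem_univ j)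
    _ ≤ _ := Finset.single_le_sum (f := fun i => ∑ j, ‖Z i j‖)
        (fun _ _ => Finset.sum_nonneg fun _ _ => norm_nonneg _) (Finset.mem_univ i)

theorem norm_negPow_coe (k : ℤ) : ‖negPow p (k : WithBot ℤ)‖ = (p : ℝ) ^ k := by
  have : negPow p (k : WithBot ℤ) = (p : ℚ_[p]) ^ (-k) := rfl
  rw [this, Padic.norm_p_zpow, neg_neg]

/-- Both sides count the diagonal entries divisible by `p ^ n` after the invertible factors are
removed. As `k` is any tuple of singular numbers of `p^{-m} A`, this also contains their uniqueness.
-/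
theorem cumul_eq_depth {m : ℕ} {A : Matrix (Fin N) (Fin N) ℤ_[p]} {k : SingularTuple N}
    (h : IsSingularTuple (scaled m A) k) (n : ℕ) : cumul k ((m : ℤ) - n) = depth n A := by
  obtain ⟨B, C, h⟩ := h
  have hp0 : (p : ℚ_[p]) ^ m ≠ 0 := pow_ne_zero m cast_prime_ne_zero
  set D : Matrix (Fin N) (Fin N) ℤ_[p] := (↑B⁻¹ : Matrix (Fin N) (Fin N) ℤ_[p]) * A *
    (↑C⁻¹ : Matrix (Fin N) (Fin N) ℤ_[p]) with hD
  have hA : A = (B : Matrix (Fin N) (Fin N) ℤ_[p]) * D * (C : Matrix (Fin N) (Fin N) ℤ_[p]) := by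
    rw [hD]; simp [mul_assoc]
  have hB1 : (↑B⁻¹ : Matrix (Fin N) (Fin N) ℤ_[p]).map (fun x => (x : ℚ_[p])) *
      (B : Matrix (Fin N) (Fin N) ℤ_[p]).map (fun x => (x : ℚ_[p])) = 1 := by
    rw [← map_coe_mul, Units.inv_mul, map_coe_one]
  have hC1 : (C : Matrix (Fin N) (Fin N) ℤ_[p]).map (fun x => (x : ℚ_[p])) *
      (↑C⁻¹ : Matrix (Fin N) (Fin N) ℤ_[p]).map (fun x => (x : ℚ_[p])) = 1 := by
    rw [← map_coe_mul, Units.mul_inv, map_coe_one]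
  have hD1 : D.map (fun x => (x : ℚ_[p])) =
      (p : ℚ_[p]) ^ m • Matrix.diagonal (fun j => negPow p (k.1 j)) := by
    have h1 : A.map (fun x => (x : ℚ_[p])) = (p : ℚ_[p]) ^ m • scaled m A := by
      rw [scaled, smul_smul, mul_inv_cancel₀ hp0, one_smul]
    rw [hD, map_coe_mul, map_coe_mul, h1, h, Matrix.mul_smul, Matrix.smul_mul]
    congr 1
    rw [← mul_assoc, ← mul_assoc, hB1, one_mul, mul_assoc, hC1, mul_one]
  -- `D` is defined over `ℤ_p` but is seen to be diagonal over `ℚ_p`; injectivity of the inclusion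
  -- transfers this back.
  have hdiag : D = Matrix.diagonal fun j => D j j := by
    ext i j
    by_cases hij : i = j
    · simp [hij]
    · rw [Matrix.diagonal_apply_ne _ hij]
      have := congrFun (congrFun hD1 i) j
      rw [Matrix.smul_apply, Matrix.diagonal_apply_ne _ hij, smul_zero, Matrix.map_apply] at this
      exact PadicInt.ext this
  have hentry (j) : ((D j j : ℤ_[p]) : ℚ_[p]) = (p : ℚ_[p]) ^ m * negPow p (k.1 j) := by
    have := congrFun (congrFun hD1 j) j
    simpa using this
  have hiff (j) : (p : ℤ_[p]) ^ n ∣ D j j ↔ k.1 j ≤ (((m : ℤ) - n : ℤ) : WithBot ℤ) := by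
    have hp1 : (1 : ℝ) < p := by exact_mod_cast hp.out.one_lt
    have hpp : (p : ℝ) ≠ 0 := by positivity
    rw [← Ideal.mem_span_singleton, ← PadicInt.norm_le_pow_iff_mem_span_pow, PadicInt.norm_def,
      hentry, norm_mul]
    generalize k.1 j = x
    induction x with
    | bot =>
      have : negPow p ⊥ = 0 := rfl
      rw [this, norm_zero, mul_zero]
      exact ⟨fun _ => bot_le, fun _ => by positivity⟩
    | coe z =>
      rw [norm_negPow_coe, WithBot.coe_le_coe, norm_pow, Padic.norm_p, inv_pow, ← zpow_natCast, ← zpow_neg, ← zpow_add₀ hpp,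
        zpow_le_zpow_iff_right₀ hp1]
      omega
  rw [hA, depth_mul_mul _ _ B.isUnit C.isUnit, hdiag, depth_diagonal, cumul_eq_card]
  simp only [hiff]
  rw [Nat.card_eq_fintype_card, Fintype.card_subtype]

theorem exists_isSingularTuple_scaled (m : ℕ) (A : Matrix (Fin N) (Fin N) ℤ_[p]) :
    ∃ k, IsSingularTuple (scaled m A) k := by
  classical
  obtain ⟨b, c, hb, hc, d, hA⟩ := isDiagonalizable A
  have hp0 : (p : ℚ_[p]) ≠ 0 := cast_prime_ne_zero
  have hd (j) : ∃ (u : ℤ_[p]ˣ) (z : WithBot ℤ),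
      ((p : ℚ_[p]) ^ m)⁻¹ * (d j : ℚ_[p]) = ((u : ℤ_[p]) : ℚ_[p]) * negPow p z := by
    rcases eq_or_ne (d j) 0 with h0 | h0
    · exact ⟨1, ⊥, by rw [h0]; simp [negPow]⟩
    · refine ⟨PadicInt.unitCoeff h0, (((m : ℤ) - (d j).valuation : ℤ) : WithBot ℤ), ?_⟩
      have h1 : negPow p (((m : ℤ) - (d j).valuation : ℤ) : WithBot ℤ) =
        (p : ℚ_[p]) ^ (-((m : ℤ) - (d j).valuation)) := rfl
      have h2 := congrArg (fun x : ℤ_[p] => (x : ℚ_[p])) (PadicInt.unitCoeff_spec h0)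
      simp only [PadicInt.coe_mul, PadicInt.coe_pow, PadicInt.coe_natCast] at h2
      rw [h1, h2, neg_sub, zpow_sub₀ hp0, zpow_natCast, zpow_natCast]
      field_simp
  choose u z hz using hd
  -- Sorting in the dual order makes the exponents decreasing; the same permutation is absorbed into
  -- both invertible factors.
  let σ := Tuple.sort (OrderDual.toDual ∘ z)
  have hanti : Antitone (z ∘ σ) := fun i j h =>
    OrderDual.toDual_le_toDual.1 (Tuple.monotone_sort (OrderDual.toDual ∘ z) h)
  have hu : IsUnit (Matrix.diagonal fun j => (u j : ℤ_[p])) := by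
    rw [Matrix.isUnit_iff_isUnit_det, Matrix.det_diagonal]
    exact IsUnit.prod_univ_iff.2 fun j => (u j).isUnit
  have hB : IsUnit ((b * Matrix.diagonal fun j => (u j : ℤ_[p])).submatrix
      (Equiv.refl (Fin N)) σ) := (Matrix.isUnit_submatrix_equiv _ _).2 (hb.mul hu)
  have hC : IsUnit (c.submatrix σ (Equiv.refl (Fin N))) := (Matrix.isUnit_submatrix_equiv _ _).2 hc
  refine ⟨⟨z ∘ σ, hanti⟩, hB.unit, hC.unit, ?_⟩
  have hdiag : Matrix.diagonal (fun j => negPow p ((z ∘ σ) j)) =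
      (Matrix.diagonal fun j => negPow p (z j)).submatrix σ σ := by
    rw [Matrix.submatrix_diagonal_equiv]
    rfl
  simp only [IsUnit.unit_spec]
  rw [hdiag, ← Matrix.submatrix_map, ← Matrix.submatrix_map, Matrix.submatrix_mul_equiv,
    Matrix.submatrix_mul_equiv, map_coe_mul, scaled, hA, map_coe_mul, map_coe_mul]
  have h1 : (Matrix.diagonal d).map (fun x => (x : ℚ_[p])) =
      Matrix.diagonal fun j => (d j : ℚ_[p]) := Matrix.diagonal_map rfl
  have h2 : (Matrix.diagonal fun j => (u j : ℤ_[p])).map (fun x => (x : ℚ_[p])) =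
      Matrix.diagonal fun j => ((u j : ℤ_[p]) : ℚ_[p]) := Matrix.diagonal_map rfl
  have h3 : ((p : ℚ_[p]) ^ m)⁻¹ • (Matrix.diagonal fun j => (d j : ℚ_[p])) =
      (Matrix.diagonal fun j => ((u j : ℤ_[p]) : ℚ_[p])) *
        Matrix.diagonal fun j => negPow p (z j) := by
    rw [Matrix.diagonal_mul_diagonal, ← Matrix.diagonal_smul]
    congr 1
    ext j
    exact hz j
  rw [h1, h2, ← Matrix.smul_mul, ← Matrix.mul_smul, h3]
  simp [mul_assoc]

theorem isSingularTuple_sing (Z : Matrix (Fin N) (Fin N) ℚ_[p]) : IsSingularTuple Z (sing Z) := by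
  have h : ∃ k, IsSingularTuple Z k := by
    obtain ⟨m, A, rfl⟩ := exists_scaled Z
    exact exists_isSingularTuple_scaled m A
  rw [sing, dif_pos h]
  exact h.choose_spec

theorem cumul_sing_scaled (m n : ℕ) (A : Matrix (Fin N) (Fin N) ℤ_[p]) :
    cumul (sing (scaled m A)) ((m : ℤ) - n) = depth n A :=
  cumul_eq_depth (isSingularTuple_sing _) n

theorem upper_sing_eq_zero_iff (m : ℕ) (Z : Matrix (Fin N) (Fin N) ℚ_[p]) :
    upper (sing Z) m = 0 ↔ Z ∈ Set.range (scaled m) := by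
  rw [upper_eq_zero_iff]
  constructor
  · intro h
    obtain ⟨B, C, hZ⟩ := isSingularTuple_sing Z
    have hp1 : (1 : ℝ) < p := by exact_mod_cast hp.out.one_lt
    have h1 : Matrix.diagonal (fun j => negPow p ((sing Z).1 j)) ∈
        Set.range (scaled (p := p) (N := N) m) := by
      rw [exists_scaled_eq_iff]
      intro i j
      by_cases hij : i = j
      · subst hij
        rw [Matrix.diagonal_apply_eq]
        have := h i
        generalize (sing Z).1 i = x at this
        induction x with
        | bot =>
          have : negPow p ⊥ = 0 := rfl
          rw [this, norm_zero]
          positivity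
        | coe z =>
          rw [norm_negPow_coe, ← zpow_natCast]
          exact zpow_le_zpow_right₀ hp1.le (WithBot.coe_le_coe.1 this)
      · rw [Matrix.diagonal_apply_ne _ hij, norm_zero]
        positivity
    obtain ⟨D, hD⟩ := h1
    refine ⟨(B : Matrix (Fin N) (Fin N) ℤ_[p]) * D * (C : Matrix (Fin N) (Fin N) ℤ_[p]), ?_⟩
    conv_rhs => rw [hZ, ← hD]
    rw [scaled, scaled, map_coe_mul, map_coe_mul, Matrix.mul_smul, Matrix.smul_mul]
  · rintro ⟨A, rfl⟩
    rw [← cumul_eq_iff]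
    have := cumul_sing_scaled m 0 A
    rwa [Nat.cast_zero, sub_zero, depth_zero, Fintype.card_fin] at this

/-- For a positive `k_j`, `p^{k_j}` is one factor `p` for each `i` with `0 ≤ i < k_j`; exchanging
the products collects `upper (sing Z) i` factors at level `i`. Hence the Hua density depends on the
upper process alone. -/
theorem gam_eq_prod {Z : Matrix (Fin N) (Fin N) ℚ_[p]} {m : ℕ} (h : upper (sing Z) m = 0) :
    gam Z = ∏ i ∈ Finset.range m, (p : ℝ) ^ upper (sing Z) i := by
  rw [upper_eq_zero_iff] at h
  simp only [upper_eq_card, ← Finset.prod_const, Finset.prod_filter]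
  rw [gam, Finset.prod_comm]
  refine Finset.prod_congr rfl fun j _ => ?_
  have hj := h j
  generalize (sing Z).1 j = x at hj
  rw [Finset.prod_ite, Finset.prod_const_one, mul_one, Finset.prod_const]
  induction x with
  | bot => simp
  | coe z =>
    have hz : z ≤ m := WithBot.coe_le_coe.1 hj
    have hcard : (Finset.range m |>.filter fun i : ℕ => ((i : ℤ) : WithBot ℤ) < (z : WithBot ℤ)) =
        Finset.range z.toNat := by
      ext i
      simp only [Finset.mem_filter, Finset.mem_range, WithBot.coe_lt_coe]
      omega
    rw [hcard, Finset.card_range]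
    split_ifs with h0
    · have h0' : 0 < z := by exact_mod_cast h0
      rw [WithBot.unbotD_coe, ← zpow_natCast, Int.toNat_of_nonneg h0'.le]
    · have h0' : z ≤ 0 := by
        by_contra hc
        exact h0 (by exact_mod_cast not_le.1 hc)
      rw [Int.toNat_of_nonpos h0', pow_zero]

/-! ### Haar measure on `Mat(N, ℚ_p)` -/

instance : SecondCountableTopology (Matrix (Fin N) (Fin N) ℚ_[p]) :=
  inferInstanceAs (SecondCountableTopology (Fin N → Fin N → ℚ_[p]))

theorem continuous_scaled (m : ℕ) : Continuous (scaled (p := p) (N := N) m) := by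
  have h : Continuous fun A : Matrix (Fin N) (Fin N) ℤ_[p] => A.map fun x => (x : ℚ_[p]) :=
    continuous_id.matrix_map continuous_subtype_val
  exact h.const_smul ((p : ℚ_[p]) ^ m)⁻¹

theorem measurableEmbedding_scaled (m : ℕ) : MeasurableEmbedding (scaled (p := p) (N := N) m) :=
  ((continuous_scaled m).isClosedEmbedding (scaled_injective m)).measurableEmbedding

theorem scaled_add (m : ℕ) (A B : Matrix (Fin N) (Fin N) ℤ_[p]) :
    scaled m (A + B) = scaled m A + scaled m B := by
  ext i j
  simp [scaled, mul_add]

instance : (vol p N).IsAddLeftInvariant := by unfold vol; infer_instance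

instance : (vol p N).IsAddHaarMeasure := by unfold vol; infer_instance

theorem vol_range_scaled_ne_top (m : ℕ) : vol p N (Set.range (scaled m)) ≠ ⊤ :=
  (isCompact_range (continuous_scaled m)).measure_lt_top.ne

/-- Each lattice `p^{-m} Mat(N, ℤ_p)` is the image of multiplication by `p` inside the next one,
where it has relative mass `p^{-N²}`. -/
theorem vol_range_scaled (m : ℕ) :
    vol p N (Set.range (scaled m)) = ((p : ENNReal) ^ (N ^ 2)) ^ m := by
  induction m with
  | zero =>
    have : Set.range (scaled (p := p) (N := N) 0) = integerMatrices p N := by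
      ext Z
      rw [exists_scaled_eq_iff, pow_zero]
      rfl
    rw [this, pow_zero]
    exact Measure.addHaarMeasure_self
  | succ m ih =>
    have h1 : Set.range (scaled (p := p) (N := N) m) = scaled (m + 1) ''
        ((fun V : Matrix (Fin N) (Fin N) ℤ_[p] => 0 + (p : ℤ_[p]) • V) '' Set.univ) := by
      rw [Set.image_univ, ← Set.range_comp]
      congr 1
      ext A i j
      have := cast_prime_ne_zero (p := p)
      simp [scaled, pow_succ]
      field_simp
    have h2 := haarInt_image_add_smul (p := p) (ι := Fin N) 0 Set.univ
    rw [Fintype.card_fin, measure_univ] at h2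
    rw [h1, measure_image_eq _ (measurableEmbedding_scaled _) _ (scaled_add _)
      (vol_range_scaled_ne_top _)] at ih
    rw [pow_succ, ← ih, mul_assoc, mul_comm (haarInt _ _ _), h2, mul_one]

theorem vol_image_scaled (m : ℕ) (E : Set (Matrix (Fin N) (Fin N) ℤ_[p])) :
    vol p N (scaled m '' E) = ((p : ENNReal) ^ (N ^ 2)) ^ m * haarInt p (Fin N) E := by
  rw [measure_image_eq _ (measurableEmbedding_scaled _) _ (scaled_add _)
      (vol_range_scaled_ne_top _), vol_range_scaled]

theorem measurable_sing : Measurable (sing (p := p) (N := N)) := by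
  refine measurable_to_countable' fun k => ?_
  obtain ⟨m, hm⟩ := exists_forall_le k
  have : sing ⁻¹' {k} = scaled (p := p) m ''
      ⋂ n, {A | depth n A = cumul k ((m : ℤ) - n)} := by
    ext Z
    simp only [Set.mem_preimage, Set.mem_singleton_iff, Set.mem_image, Set.mem_iInter,
      Set.mem_ofPred_eq]
    constructor
    · rintro rfl
      obtain ⟨A, rfl⟩ := (upper_sing_eq_zero_iff m Z).1 ((upper_eq_zero_iff _ m).2 hm)
      exact ⟨A, fun n => (cumul_sing_scaled m n A).symm, rfl⟩
    · rintro ⟨A, hA, rfl⟩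
      refine eq_of_cumul_eq fun i => ?_
      -- The depths determine `cumul` up to level `m`; above it both functions have already reached
      -- `N`.
      rcases le_or_gt i m with hi | hi
      · have := hA ((m : ℤ) - i).toNat
        rw [← cumul_sing_scaled m, Int.toNat_of_nonneg (by omega), sub_sub_cancel] at this
        exact this
      · have h1 : cumul k m = N := (cumul_eq_iff _ _).2 hm
        have h2 : cumul (sing (scaled m A)) m = N := by
          have := cumul_sing_scaled m 0 A
          rwa [Nat.cast_zero, sub_zero, depth_zero, Fintype.card_fin] at this
        have h3 := cumul_mono k hi.le
        have h4 := cumul_mono (sing (scaled m A)) hi.le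
        have h5 := cumul_le k i
        have h6 := cumul_le (sing (scaled m A)) i
        omega
  rw [this]
  exact (measurableEmbedding_scaled m).measurableSet_image.2
    (MeasurableSet.iInter fun n => measurableSet_depth n _)

end

/-! ### The law of the two processes under `m_N^{(s)}` -/

/-- The tuples whose upper process starts with `a 0, …, a l` and whose lower process starts with
`b 0, …, b n`. -/
def pathEvent (N l n : ℕ) (a b : ℕ → ℕ) : Set (SingularTuple N) :=
  {k | (∀ i ≤ l, upper k i = a i) ∧ ∀ i ≤ n, lower k i = b i}

/-- The path `i ↦ #{j : k_j ≤ m - i}` obtained by running the upper process backwards from time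
`m` and then the lower process. -/
def joinedPath (N m : ℕ) (a b : ℕ → ℕ) (i : ℕ) : ℕ :=
  if i ≤ m then N - a (m - i) else b (i - m)

section
variable {p : ℕ} [hp : Fact p.Prime] {N : ℕ} {s : ℝ}

/-- The condition `a m = 0` places the matrix in `p^{-m} Mat(N, ℤ_p)`, where the upper and lower
processes together are a single depth sequence of length `m + n`. -/
theorem preimage_pathEvent {m n : ℕ} {a b : ℕ → ℕ} (ha : ∀ i ≤ m, a i ≤ N) (ham : a m = 0)
    (h0 : a 0 = N - b 0) (hb : b 0 ≤ N) :
    sing ⁻¹' pathEvent N m n a b =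
      scaled (p := p) m '' {A | ∀ i ≤ m + n, depth i A = joinedPath N m a b i} := by
  ext Z
  simp only [Set.mem_preimage, Set.mem_image, pathEvent, Set.mem_ofPred_eq]
  constructor
  · rintro ⟨hu, hl⟩
    obtain ⟨A, rfl⟩ := (upper_sing_eq_zero_iff m Z).1 ((hu m le_rfl).trans ham)
    refine ⟨A, fun i hi => ?_, rfl⟩
    rw [← cumul_sing_scaled m, joinedPath]
    split_ifs with h
    · rw [← hu (m - i) (by omega), ← cumul_natCast, Nat.cast_sub h]
    · rw [← hl (i - m) (by omega), lower, Nat.cast_sub (by omega), neg_sub]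
  · rintro ⟨A, hA, rfl⟩
    constructor
    · intro i hi
      have := hA (m - i) (by omega)
      rw [← cumul_sing_scaled m, Nat.cast_sub hi, sub_sub_cancel, joinedPath, if_pos (by omega),
        Nat.sub_sub_self hi] at this
      have h1 := ha i hi
      rw [upper, this]
      omega
    · intro i hi
      have := hA (m + i) (by omega)
      rw [← cumul_sing_scaled m, Nat.cast_add, sub_add_cancel_left, joinedPath] at this
      rw [lower, this]
      split_ifs with h
      · obtain rfl : i = 0 := by omega
        rw [Nat.add_zero, Nat.sub_self, h0]
        omega
      · rw [Nat.add_sub_cancel_left]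

omit hp in
theorem prod_transition_joinedPath {m n : ℕ} {a b : ℕ → ℕ} (h0 : a 0 = N - b 0) (hb : b 0 ≤ N) :
    ∏ i ∈ Finset.range (m + n),
        transition p 0 (joinedPath N m a b i) (joinedPath N m a b (i + 1)) =
      (∏ i ∈ Finset.range m, transition p 0 (N - a (i + 1)) (N - a i)) *
        ∏ i ∈ Finset.range n, transition p 0 (b i) (b (i + 1)) := by
  rw [Finset.prod_range_add]
  congr 1
  · rw [← Finset.prod_range_reflect]
    refine Finset.prod_congr rfl fun i hi => ?_
    rw [Finset.mem_range] at hi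
    rw [joinedPath, joinedPath, if_pos (by omega), if_pos (by omega),
      show m - (m - 1 - i) = i + 1 by omega, show m - (m - 1 - i + 1) = i by omega]
  · refine Finset.prod_congr rfl fun i _ => ?_
    have h1 : joinedPath N m a b (m + i) = b i := by
      rw [joinedPath]
      split_ifs with h
      · obtain rfl : i = 0 := by omega
        rw [Nat.add_zero, Nat.sub_self, h0]
        omega
      · rw [Nat.add_sub_cancel_left]
    rw [h1, joinedPath, if_neg (by omega), show m + i + 1 - m = i + 1 by omega]

/-- Detailed balance applied along the path: the initial-law factors telescope, leaving those at the
two ends. -/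
theorem prod_pow_mul_transition_zero (hs : -1 < s) {m : ℕ} {a : ℕ → ℕ}
    (ha : ∀ i < m, a (i + 1) ≤ a i) (haN : ∀ i ≤ m, a i ≤ N) :
    (∏ i ∈ Finset.range m, (p : ℝ) ^ (N ^ 2) * (p : ℝ) ^ (-(s + 2 * N) * a i) *
      transition p 0 (N - a (i + 1)) (N - a i)) * initialLaw p N s (N - a m) =
    initialLaw p N s (N - a 0) * ∏ i ∈ Finset.range m, transition p s (a i) (a (i + 1)) := by
  induction m with
  | zero => simp
  | succ m ih =>
    have h1 := ih (fun i hi => ha i (by omega)) fun i hi => haN i (by omega)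
    have h2 := pow_mul_transition_zero (p := p) hs (ha m (by omega)) (haN m (by omega))
    rw [Finset.prod_range_succ, Finset.prod_range_succ, mul_assoc, h2]
    linear_combination transition p s (a m) (a (m + 1)) * h1

theorem singularLaw_apply (E : Set (SingularTuple N)) :
    singularLaw p N s E = huaMeasure p N s (sing ⁻¹' E) :=
  Measure.map_apply measurable_sing trivial

theorem initialLaw_self : initialLaw p N s N = pochS p s N ^ 2 / pochS p s (2 * N) := by
  have h1 := (poch_pos (p := p) N).ne'
  have h2 : poch p 0 = 1 := qPoch_zero _ _
  have h3 : pochS p s 0 = 1 := qPoch_zero _ _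
  rw [initialLaw, if_pos le_rfl, Nat.sub_self, h2, h3]
  simp
  field_simp

/-- The density is constant on the event, so its mass is that constant times a volume given by
`haarInt_depth`. The normalizing constant equals `π_N^{(s)}(N)`, the end term of the telescoping
product. -/
theorem singularLaw_pathEvent_of_antitone (hs : -1 < s) {m n : ℕ} {a b : ℕ → ℕ}
    (ha : ∀ i < m, a (i + 1) ≤ a i) (ham : a m = 0) (h0 : a 0 = N - b 0) (hb : b 0 ≤ N) :
    singularLaw p N s (pathEvent N m n a b) =
      ENNReal.ofReal (initialLaw p N s (b 0) *
        (∏ i ∈ Finset.range m, transition p s (a i) (a (i + 1))) *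
        ∏ i ∈ Finset.range n, transition p 0 (b i) (b (i + 1))) := by
  have hp0 : 0 < (p : ℝ) := by exact_mod_cast hp.out.pos
  have haN : ∀ i ≤ m, a i ≤ N := by
    intro i hi
    induction i with
    | zero => omega
    | succ i ih => exact (ha i (by omega)).trans (ih (by omega))
  have hset := preimage_pathEvent (p := p) (n := n) haN ham h0 hb
  have hmeas : MeasurableSet (sing (p := p) ⁻¹' pathEvent N m n a b) := measurable_sing trivial
  set G : ℝ := ∏ i ∈ Finset.range m, (p : ℝ) ^ a i with hG
  have hgam : ∀ Z ∈ sing (p := p) ⁻¹' pathEvent N m n a b, gam Z = G := by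
    intro Z hZ
    have hu : ∀ i ≤ m, upper (sing Z) i = a i := hZ.1
    rw [gam_eq_prod ((hu m le_rfl).trans ham)]
    exact Finset.prod_congr rfl fun i hi => by rw [hu i (Finset.mem_range.1 hi).le]
  have hC : 0 ≤ pochS p s N ^ 2 / pochS p s (2 * N) :=
    div_nonneg (sq_nonneg _) (pochS_pos hs _).le
  have hy : joinedPath N m a b 0 = Fintype.card (Fin N) := by
    rw [joinedPath, if_pos (Nat.zero_le _), Nat.sub_zero, ham, Fintype.card_fin, Nat.sub_zero]
  have hGpow : G ^ (-s - 2 * (N : ℝ)) =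
      ∏ i ∈ Finset.range m, (p : ℝ) ^ (-(s + 2 * N) * a i) := by
    rw [hG, ← Real.finsetProd_rpow _ _ fun i _ => by positivity]
    refine Finset.prod_congr rfl fun i _ => ?_
    rw [← Real.rpow_natCast, ← Real.rpow_mul hp0.le]
    ring_nf
  rw [singularLaw_apply, huaMeasure, withDensity_apply _ hmeas,
    setLIntegral_congr_fun hmeas (fun Z hZ => by rw [hgam Z hZ]), setLIntegral_const, hset,
    vol_image_scaled, haarInt_depth _ _ _ hy, prod_transition_joinedPath h0 hb,
    ← ENNReal.ofReal_natCast, ← ENNReal.ofReal_pow (by positivity),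
    ← ENNReal.ofReal_pow (by positivity), ← ENNReal.ofReal_mul (by positivity),
    ← ENNReal.ofReal_mul (by positivity)]
  congr 1
  have h1 := prod_pow_mul_transition_zero (p := p) (N := N) hs ha haN
  have h2 : N - a 0 = b 0 := by omega
  rw [ham, Nat.sub_zero, initialLaw_self, h2, Finset.prod_mul_distrib, Finset.prod_mul_distrib,
    Finset.prod_const, Finset.card_range, ← hGpow] at h1
  linear_combination (∏ i ∈ Finset.range n, transition p 0 (b i) (b (i + 1))) * h1

theorem singularLaw_pathEvent_of_eq_zero (hs : -1 < s) {m n : ℕ} {a b : ℕ → ℕ}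
    (ham : a m = 0) (h0 : a 0 = N - b 0) (hb : b 0 ≤ N) :
    singularLaw p N s (pathEvent N m n a b) =
      ENNReal.ofReal (initialLaw p N s (b 0) *
        (∏ i ∈ Finset.range m, transition p s (a i) (a (i + 1))) *
        ∏ i ∈ Finset.range n, transition p 0 (b i) (b (i + 1))) := by
  -- For a path that increases somewhere, the event is empty and a transition factor is zero.
  by_cases ha : ∀ i < m, a (i + 1) ≤ a i
  · exact singularLaw_pathEvent_of_antitone hs ha ham h0 hb
  push Not at ha
  obtain ⟨i, hi, hlt⟩ := ha
  have h1 : pathEvent N m n a b = ∅ := by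
    rw [Set.eq_empty_iff_forall_notMem]
    rintro k ⟨hu, -⟩
    have := upper_antitone k (Nat.le_succ i)
    rw [hu i hi.le, Nat.succ_eq_add_one, hu (i + 1) hi] at this
    omega
  rw [h1, measure_empty, Finset.prod_eq_zero (f := fun i => transition p s (a i) (a (i + 1)))
    (Finset.mem_range.2 hi) (transition_of_lt hlt), mul_zero, zero_mul, ENNReal.ofReal_zero]

/-- Induction on the number `m` of further steps allowed before reaching `0`: the event is split
according to the next value of the upper process, matching the recursion of `absorbed`. -/
theorem singularLaw_pathEvent_inter (hs : -1 < s) (m n : ℕ) {b : ℕ → ℕ} (hb : b 0 ≤ N) :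
    ∀ (l : ℕ) (a : ℕ → ℕ) (_ : a 0 = N - b 0),
    singularLaw p N s (pathEvent N l n a b ∩ {k | upper k (l + m) = 0}) =
      ENNReal.ofReal (initialLaw p N s (b 0) *
        (∏ i ∈ Finset.range l, transition p s (a i) (a (i + 1))) *
        (∏ i ∈ Finset.range n, transition p 0 (b i) (b (i + 1))) * absorbed p s m (a l)) := by
  have hs0 : (-1 : ℝ) < 0 := by norm_num
  induction m with
  | zero =>
    intro l a h0
    by_cases hal : a l = 0
    · rw [absorbed, if_pos hal, mul_one, ← singularLaw_pathEvent_of_eq_zero hs hal h0 hb]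
      congr 1
      refine Set.inter_eq_left.2 fun k hk => ?_
      exact (hk.1 l le_rfl).trans hal
    · rw [absorbed, if_neg hal, mul_zero, ENNReal.ofReal_zero]
      convert measure_empty (μ := singularLaw p N s)
      rw [Set.eq_empty_iff_forall_notMem]
      rintro k ⟨hk, hk'⟩
      exact hal ((hk.1 l le_rfl).symm.trans hk')
  | succ m ih =>
    intro l a h0
    have hset : pathEvent N l n a b ∩ {k | upper k (l + (m + 1)) = 0} =
        ⋃ x ∈ Finset.range (a l + 1),
          (pathEvent N (l + 1) n (Function.update a (l + 1) x) b ∩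
            {k | upper k (l + 1 + m) = 0}) := by
      ext k
      simp only [Set.mem_inter_iff, Set.mem_iUnion, Finset.mem_range, pathEvent, Set.mem_ofPred_eq,
        show l + (m + 1) = l + 1 + m by ring]
      constructor
      · rintro ⟨⟨hu, hl⟩, h⟩
        refine ⟨upper k (l + 1), ?_, ⟨fun i hi => ?_, hl⟩, h⟩
        · rw [← hu l le_rfl]
          exact Nat.lt_succ_of_le (upper_antitone k (Nat.le_succ l))
        · rcases Nat.lt_or_ge i (l + 1) with h' | h'
          · rw [Function.update_of_ne h'.ne, hu i (by omega)]
          · obtain rfl : i = l + 1 := by omega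
            rw [Function.update_self]
      · rintro ⟨x, -, ⟨hu, hl⟩, h⟩
        refine ⟨⟨fun i hi => ?_, hl⟩, h⟩
        rw [hu i (by omega), Function.update_of_ne (by omega)]
    rw [hset, measure_biUnion_finset]
    · have hterm (x : ℕ) := ih (l + 1) (Function.update a (l + 1) x)
        (by rw [Function.update_of_ne (by omega), h0])
      simp only [hterm]
      rw [← ENNReal.ofReal_sum_of_nonneg]
      · congr 1
        rw [absorbed, Finset.mul_sum]
        refine Finset.sum_congr rfl fun x _ => ?_
        rw [Finset.prod_range_succ, Function.update_self, Function.update_of_ne (by omega)]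
        have : ∏ i ∈ Finset.range l, transition p s (Function.update a (l + 1) x i)
            (Function.update a (l + 1) x (i + 1)) =
            ∏ i ∈ Finset.range l, transition p s (a i) (a (i + 1)) :=
          Finset.prod_congr rfl fun i hi => by
            rw [Finset.mem_range] at hi
            rw [Function.update_of_ne (by omega), Function.update_of_ne (by omega)]
        rw [this]
        ring
      · intro x _
        have h1 := initialLaw_nonneg (p := p) hs N (b 0)
        have h2 := Finset.prod_nonneg fun i (_ : i ∈ Finset.range n) =>
          transition_nonneg (p := p) hs0 (b i) (b (i + 1))
        have h3 := Finset.prod_nonneg fun i (_ : i ∈ Finset.range (l + 1)) =>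
          transition_nonneg (p := p) hs (Function.update a (l + 1) x i)
            (Function.update a (l + 1) x (i + 1))
        have h4 := absorbed_nonneg (p := p) hs m (Function.update a (l + 1) x (l + 1))
        positivity
    · intro x _ x' _ hne
      refine Set.disjoint_left.2 fun k hk hk' => hne ?_
      have h1 := hk.1.1 (l + 1) le_rfl
      have h2 := hk'.1.1 (l + 1) le_rfl
      rw [Function.update_self] at h1 h2
      exact h1.symm.trans h2
    · exact fun _ _ => trivial

/-- Every tuple has its entries bounded above, so its upper process vanishes eventually and the
events with `upper k (l + m) = 0` exhaust the path event. On the other side the absorption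
probability tends to one. -/
theorem singularLaw_pathEvent (hs : -1 < s) (l n : ℕ) {a b : ℕ → ℕ} (hb : b 0 ≤ N)
    (h0 : a 0 = N - b 0) :
    singularLaw p N s (pathEvent N l n a b) =
      ENNReal.ofReal (initialLaw p N s (b 0) *
        (∏ i ∈ Finset.range l, transition p s (a i) (a (i + 1))) *
        ∏ i ∈ Finset.range n, transition p 0 (b i) (b (i + 1))) := by
  have hmono : Monotone fun m => pathEvent N l n a b ∩ {k | upper k (l + m) = 0} := by
    refine fun m m' h => Set.inter_subset_inter_right _ fun k hk => ?_
    exact Nat.le_zero.1 (hk ▸ upper_antitone k (Nat.add_le_add_left h l))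
  have hunion : ⋃ m, (pathEvent N l n a b ∩ {k | upper k (l + m) = 0}) = pathEvent N l n a b := by
    rw [← Set.inter_iUnion]
    refine Set.inter_eq_left.2 fun k _ => ?_
    obtain ⟨m, hm⟩ := exists_forall_le k
    have h1 := (upper_eq_zero_iff k m).2 hm
    exact Set.mem_iUnion.2 ⟨m, Nat.le_zero.1 (h1 ▸ upper_antitone k (Nat.le_add_left m l))⟩
  have h1 := tendsto_measure_iUnion_atTop (μ := singularLaw p N s) hmono
  rw [hunion] at h1
  refine tendsto_nhds_unique h1 ?_
  simp only [Function.comp_def, singularLaw_pathEvent_inter hs _ n hb l a h0]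
  have h2 := (tendsto_absorbed (p := p) hs (a l)).const_mul (initialLaw p N s (b 0) *
    (∏ i ∈ Finset.range l, transition p s (a i) (a (i + 1))) *
    ∏ i ∈ Finset.range n, transition p 0 (b i) (b (i + 1)))
  rw [mul_one] at h2
  exact ENNReal.tendsto_ofReal h2

/-! ### The sampling procedure realized by `m_N^{(s)}`. -/

theorem singularLaw_lower_zero (hs : -1 < s) (x : ℕ) :
    singularLaw p N s {k | lower k 0 = x} = ENNReal.ofReal (initialLaw p N s x) := by
  rcases le_or_gt x N with hx | hx
  · have h := singularLaw_pathEvent (p := p) (N := N) hs 0 0 (a := fun _ => N - x)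
      (b := fun _ => x) hx rfl
    simp only [Finset.range_zero, Finset.prod_empty, mul_one] at h
    rw [← h]
    congr 1
    ext k
    simp only [pathEvent, Set.mem_ofPred_eq, Nat.le_zero, forall_eq]
    exact ⟨fun h => ⟨by rw [upper_zero, h], h⟩, fun h => h.2⟩
  · have h : {k : SingularTuple N | lower k 0 = x} = ∅ := by
      rw [Set.eq_empty_iff_forall_notMem]
      intro k hk
      have h1 := lower_le k 0
      have h2 : lower k 0 = x := hk
      omega
    rw [h, measure_empty, initialLaw, if_neg (by omega), ENNReal.ofReal_zero]

/-- The total mass is computed by partitioning by the value of `Y_0`, so the normalization of the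
Hua measure reduces to that of `π_N^{(s)}`. -/
theorem isProbabilityMeasure_singularLaw (hs : -1 < s) :
    IsProbabilityMeasure (singularLaw p N s) := by
  refine ⟨?_⟩
  have h : (Set.univ : Set (SingularTuple N)) =
      ⋃ x ∈ Finset.range (N + 1), {k | lower k 0 = x} := by
    ext k
    simpa using Nat.lt_succ_of_le (lower_le k 0)
  rw [h, measure_biUnion_finset, Finset.sum_congr rfl fun x _ => singularLaw_lower_zero hs x,
    ← ENNReal.ofReal_sum_of_nonneg fun x _ => initialLaw_nonneg hs N x, sum_initialLaw hs,
    ENNReal.ofReal_one]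
  · exact fun x _ x' _ hne => Set.disjoint_left.2 fun k hk hk' => hne (hk.symm.trans hk')
  · exact fun _ _ => trivial

theorem isTwoChainSample_singularLaw (hs : -1 < s) :
    IsTwoChainSample p N s (singularLaw p N s) (fun i k => upper k i) (fun i k => lower k i) where
  measurable_X _ := measurable_from_top
  measurable_Y _ := measurable_from_top
  init := singularLaw_lower_zero hs
  start := Filter.Eventually.of_forall upper_zero
  run n a b h0 := by
    have hs0 : (-1 : ℝ) < 0 := by norm_num
    have hset : {k : SingularTuple N | ∀ i ≤ n, upper k i = a i ∧ lower k i = b i} =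
        pathEvent N n n a b := by
      ext k
      exact ⟨fun h => ⟨fun i hi => (h i hi).1, fun i hi => (h i hi).2⟩,
        fun h i hi => ⟨h.1 i hi, h.2 i hi⟩⟩
    rw [hset, singularLaw_lower_zero hs]
    rcases le_or_gt (b 0) N with hb | hb
    · rw [singularLaw_pathEvent hs n n hb h0, ← ENNReal.ofReal_prod_of_nonneg,
        ← ENNReal.ofReal_prod_of_nonneg, ← ENNReal.ofReal_mul, ← ENNReal.ofReal_mul, mul_assoc]
      · exact initialLaw_nonneg hs N _
      · exact Finset.prod_nonneg fun i _ => transition_nonneg hs _ _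
      · exact fun i _ => transition_nonneg hs0 _ _
      · exact fun i _ => transition_nonneg hs _ _
    · have h : pathEvent N n n a b = ∅ := by
        rw [Set.eq_empty_iff_forall_notMem]
        rintro k ⟨-, hl⟩
        have h1 := lower_le k 0
        have h2 := hl 0 (Nat.zero_le _)
        omega
      rw [h, measure_empty, initialLaw, if_neg (by omega), ENNReal.ofReal_zero, zero_mul]

/-! ### Reconstruction of the tuple from the two processes -/

omit hp in
theorem IsTwoChainSample.tendsto_measure_path {Ω : Type*} [MeasurableSpace Ω] {μ : Measure Ω}
    [IsFiniteMeasure μ] {X Y : ℕ → Ω → ℕ} (h : IsTwoChainSample p N s μ X Y) (a b : ℕ → ℕ) :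
    Filter.Tendsto (fun n => μ {ω | ∀ i ≤ n, X i ω = a i ∧ Y i ω = b i}) Filter.atTop
      (nhds (μ {ω | (∀ i, X i ω = a i) ∧ ∀ i, Y i ω = b i})) := by
  have hset : {ω | (∀ i, X i ω = a i) ∧ ∀ i, Y i ω = b i} =
      ⋂ n, {ω | ∀ i ≤ n, X i ω = a i ∧ Y i ω = b i} := by
    ext ω
    simp only [Set.mem_iInter, Set.mem_ofPred_eq]
    exact ⟨fun h n i _ => ⟨h.1 i, h.2 i⟩,
      fun h => ⟨fun i => (h i i le_rfl).1, fun i => (h i i le_rfl).2⟩⟩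
  rw [hset]
  refine tendsto_measure_iInter_atTop (fun n => ?_) ?_ ⟨0, measure_ne_top _ _⟩
  · have : {ω | ∀ i ≤ n, X i ω = a i ∧ Y i ω = b i} =
        ⋂ i, ⋂ (_ : i ≤ n), (X i ⁻¹' {a i} ∩ Y i ⁻¹' {b i}) := by
      ext ω
      simp
    rw [this]
    exact (MeasurableSet.iInter fun i => MeasurableSet.iInter fun _ =>
      (h.measurable_X i (measurableSet_singleton _)).inter
        (h.measurable_Y i (measurableSet_singleton _))).nullMeasurableSet
  · exact fun n n' hn ω hω i hi => hω i (hi.trans hn)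

-- A full path is a decreasing limit of finite cylinders, whose probabilities the procedure
-- prescribes. Two runs on different spaces thus give each full path the same mass.
omit hp in
theorem IsTwoChainSample.measure_path {Ω : Type*} [MeasurableSpace Ω] {μ : Measure Ω}
    [IsFiniteMeasure μ] {X Y : ℕ → Ω → ℕ} (h : IsTwoChainSample p N s μ X Y)
    {Ω' : Type*} [MeasurableSpace Ω'] {μ' : Measure Ω'} [IsFiniteMeasure μ'] {X' Y' : ℕ → Ω' → ℕ}
    (h' : IsTwoChainSample p N s μ' X' Y') {a b : ℕ → ℕ} (h0 : a 0 = N - b 0) :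
    μ {ω | (∀ i, X i ω = a i) ∧ ∀ i, Y i ω = b i} =
      μ' {ω | (∀ i, X' i ω = a i) ∧ ∀ i, Y' i ω = b i} := by
  refine tendsto_nhds_unique (h.tendsto_measure_path a b) ?_
  simp only [h.run _ a b h0, h.init]
  simpa only [h'.run _ a b h0, h'.init] using h'.tendsto_measure_path a b

/-- Comparison with the run on `Δ_N` itself gives `μ (A k) = m_N^{(s)}({k})`. As `Δ_N` is countable
and these masses add up to one, the disjoint events `A k` cover almost every `ω`. -/
theorem IsTwoChainSample.exists_tuple (hs : -1 < s) {Ω : Type*} [MeasurableSpace Ω] {μ : Measure Ω}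
    [IsProbabilityMeasure μ] {X Y : ℕ → Ω → ℕ} (h : IsTwoChainSample p N s μ X Y) :
    ∃ κ : Ω → SingularTuple N, Measurable κ ∧
      (∀ᵐ ω ∂μ, ∀ k : SingularTuple N,
        ((∀ i, upper k i = X i ω) ∧ (∀ i, lower k i = Y i ω)) ↔ k = κ ω) ∧
      μ.map κ = singularLaw p N s := by
  classical
  have := isProbabilityMeasure_singularLaw (p := p) (N := N) hs
  let A (k : SingularTuple N) : Set Ω :=
    {ω | (∀ i, X i ω = upper k i) ∧ ∀ i, Y i ω = lower k i}
  have hA (k : SingularTuple N) : MeasurableSet (A k) := by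
    have : A k = ⋂ i, (X i ⁻¹' {upper k i} ∩ Y i ⁻¹' {lower k i}) := by
      ext ω
      simp [A, forall_and]
    rw [this]
    exact MeasurableSet.iInter fun i =>
      (h.measurable_X i (measurableSet_singleton _)).inter
        (h.measurable_Y i (measurableSet_singleton _))
  have huniq {k k' : SingularTuple N} {ω : Ω} (hk : ω ∈ A k) (hk' : ω ∈ A k') : k = k' :=
    eq_of_upper_lower (fun i => (hk.1 i).symm.trans (hk'.1 i))
      fun i => (hk.2 i).symm.trans (hk'.2 i)
  have hdisj : Pairwise (Function.onFun Disjoint A) := fun k k' hne =>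
    Set.disjoint_left.2 fun ω hk hk' => hne (huniq hk hk')
  have hμA (k : SingularTuple N) : μ (A k) = singularLaw p N s {k} := by
    rw [h.measure_path (isTwoChainSample_singularLaw hs) (upper_zero k)]
    congr 1
    ext k'
    exact ⟨fun h => eq_of_upper_lower h.1 h.2, fun h => by
      rw [Set.mem_singleton_iff.1 h]
      exact ⟨fun _ => rfl, fun _ => rfl⟩⟩
  have hgood : μ (⋃ k, A k) = 1 := by
    rw [measure_iUnion hdisj hA]
    simp only [hμA]
    rw [← measure_iUnion (fun k k' hne => Set.disjoint_singleton.2 hne)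
      fun _ => MeasurableSpace.measurableSet_top,
      Set.iUnion_of_singleton, measure_univ]
  have hae : ∀ᵐ ω ∂μ, ω ∈ ⋃ k, A k :=
    (prob_compl_eq_zero_iff (MeasurableSet.iUnion hA)).2 hgood
  let κ : Ω → SingularTuple N := fun ω =>
    if hω : ∃ k, ω ∈ A k then hω.choose else SingularTuple.bot N
  have hκ {k : SingularTuple N} {ω : Ω} (hk : ω ∈ A k) : κ ω = k := by
    have hex : ∃ k, ω ∈ A k := ⟨k, hk⟩
    simp only [κ, dif_pos hex]
    exact huniq hex.choose_spec hk
  -- Outside all the `A k`, a null set, `κ` takes the default value, which enlarges one fibre only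
  -- and keeps `κ` measurable.
  have hpre (k : SingularTuple N) :
      κ ⁻¹' {k} = A k ∪ if k = SingularTuple.bot N then (⋃ k, A k)ᶜ else ∅ := by
    ext ω
    by_cases hω : ω ∈ ⋃ k, A k
    · obtain ⟨k', hk'⟩ := Set.mem_iUnion.1 hω
      have h1 : ω ∉ (if k = SingularTuple.bot N then (⋃ k, A k)ᶜ else ∅ : Set Ω) := by
        split_ifs <;> simp [Set.mem_iUnion.1 hω]
      simp only [Set.mem_preimage, Set.mem_singleton_iff, hκ hk', Set.mem_union, h1, or_false]
      exact ⟨fun e => e ▸ hk', fun e => huniq hk' e⟩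
    · have h1 : ω ∉ A k := fun hk => hω (Set.mem_iUnion.2 ⟨k, hk⟩)
      have h2 : κ ω = SingularTuple.bot N := dif_neg fun hex => hω (Set.mem_iUnion.2 hex)
      simp only [Set.mem_preimage, Set.mem_singleton_iff, h2, Set.mem_union, h1, false_or]
      split_ifs with h3
      · exact ⟨fun _ => hω, fun _ => h3.symm⟩
      · exact ⟨fun e => absurd e.symm h3, fun e => e.elim⟩
  have hκm : Measurable κ := by
    refine measurable_to_countable' fun k => ?_
    rw [hpre]
    refine (hA k).union ?_
    split_ifs
    · exact (MeasurableSet.iUnion hA).compl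
    · exact MeasurableSet.empty
  refine ⟨κ, hκm, ?_, ?_⟩
  · filter_upwards [hae] with ω hω k
    obtain ⟨k', hk'⟩ := Set.mem_iUnion.1 hω
    rw [hκ hk']
    constructor
    · exact fun hk => huniq ⟨fun i => (hk.1 i).symm, fun i => (hk.2 i).symm⟩ hk'
    · rintro rfl
      exact ⟨fun i => (hk'.1 i).symm, fun i => (hk'.2 i).symm⟩
  · refine Measure.ext_of_singleton fun k => ?_
    rw [Measure.map_apply hκm trivial, ← hμA]
    refine measure_congr ?_
    filter_upwards [hae] with ω hω
    obtain ⟨k', hk'⟩ := Set.mem_iUnion.1 hω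
    refine propext ⟨fun e => ?_, fun e => hκ e⟩
    have e' : κ ω = k := e
    rw [hκ hk'] at e'
    exact e' ▸ hk'

end

end PadicHua

theorem theorem3p5 (p : ℕ) [Fact p.Prime] (N : ℕ) (hN : 1 ≤ N) (s : ℝ) (hs : -1 < s) :
    -- `π_N^{(s)}` is a probability measure on `{0, …, N}`
    ((∀ x ≤ N, 0 ≤ PadicHua.initialLaw p N s x) ∧
      ∑ x ∈ Finset.range (N + 1), PadicHua.initialLaw p N s x = 1) ∧
    -- under `m_N^{(s)}`, the two processes attached to `k` are the output of the procedure
    PadicHua.IsTwoChainSample p N s (PadicHua.singularLaw p N s)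
      (fun i k => PadicHua.upper k i) (fun i k => PadicHua.lower k i) ∧
    -- every run of the procedure almost surely determines a unique `k`, and its law is `m_N^{(s)}`
    (∀ (Ω : Type*) [MeasurableSpace Ω] (μ : MeasureTheory.Measure Ω)
        [MeasureTheory.IsProbabilityMeasure μ] (X Y : ℕ → Ω → ℕ),
      PadicHua.IsTwoChainSample p N s μ X Y →
        ∃ κ : Ω → PadicHua.SingularTuple N, Measurable κ ∧
          (∀ᵐ ω ∂μ, ∀ k : PadicHua.SingularTuple N,
            ((∀ i, PadicHua.upper k i = X i ω) ∧ (∀ i, PadicHua.lower k i = Y i ω)) ↔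
              k = κ ω) ∧
          μ.map κ = PadicHua.singularLaw p N s) := by
  refine ⟨⟨fun x _ => PadicHua.initialLaw_nonneg hs N x, PadicHua.sum_initialLaw hs N⟩,
    PadicHua.isTwoChainSample_singularLaw hs, ?_⟩
  intro Ω _ μ _ X Y h
  exact h.exists_tuple hs
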